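/- Let $p,q\ge 0$ be integers and let $$y(t)=\sum_{j=1}^{p}\{A_j^0\cos(\alpha_j^0t)+B_j^0\sin(\alpha_j^0t)\}+\sum_{k=1}^{q}\{C_k^0\cos(\beta_k^0t^2)+D_k^0\sin(\beta_k^0t^2)\}+X(t),\qquad t=1,2,\dots,$$ where $X(t)=\sum_{j\in\mathbb Z}a(j)e(t-j)$, the $a(j)$ are real with $\sum_{j}|a(j)|<\infty$, and $(e(t))_{t\in\mathbb Z}$ are i.i.d. random variables with mean $0$ and finite variance $\sigma^2$. Write ${\theta_j^0}^{(1)}=(A_j^0,B_j^0,\alpha_j^0)$ and ${\theta_k^0}^{(2)}=(C_k^0,D_k^0,\beta_k^0)$. Assume that, for some $M>0$: 1. the vector of all ${\theta_j^0}^{(1)}$ and ${\theta_k^0}^{(2)}$ is an interior point of $([-M,M]\times[-M,M]\times[0,\pi])^{p+q}$, the $\alpha_j^0$ are distinct and the $\beta_k^0$ are distinct; 2. ${A_1^0}^2+{B_1^0}^2>\dots>{A_p^0}^2+{B_p^0}^2>0$ and ${C_1^0}^2+{D_1^0}^2>\dots>{C_q^0}^2+{D_q^0}^2>0$; 3. no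 $\beta_k^0$ is a rational multiple of $\pi$. Sequential least squares estimators $\tilde\theta^{(1)}_j=(\tilde A_j,\tilde B_j,\tilde\alpha_j)$ and $\tilde\theta^{(2)}_k=(\tilde C_k,\tilde D_k,\tilde\beta_k)$ from $y(1),\dots,y(n)$ are defined as follows. Put $y_0=y$. For $j=1,\dots,p$, $\tilde\theta^{(1)}_j$ minimises $\sum_{t=1}^n(y_{j-1}(t)-A\cos(\alpha t)-B\sin(\alpha t))^2$ over $A,B\in K$, $\alpha\in[0,\pi]$, and $y_j(t)=y_{j-1}(t)-\tilde A_j\cos(\tilde\alpha_jt)-\tilde B_j\sin(\tilde\alpha_jt)$. Then, for $k=1,\dots,q$, $\tilde\theta^{(2)}_k$ minimises $\sum_{t=1}^n(y_{p+k-1}(t)-C\cos(\beta t^2)-D\sin(\beta t^2))^2$ over $C,D\in K$, $\beta\in[0,\pi]$, and $y_{p+k}(t)=y_{p+k-1}(t)-\tilde C_k\cos(\tilde\beta_kt^2)-\tilde D_k\sin(\tilde\beta_kt^2)$. Here $K\subseteq\mathbb R$ is any fixed set with $[-M,M]\subseteq K$ (for instance $K=\mathbb R$ or $K=[-M,M]$).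 Let $\tilde\theta^{(1)}_j,\tilde\theta^{(2)}_k$ be any functions of $n$ and the sample point that, almost surely, are such minimisers for all sufficiently large $n$. Then, as $n\to\infty$: (a) if $p\ge1$, then $\tilde\theta_1^{(1)}\to{\theta_1^0}^{(1)}$ almost surely; (b) if $q\ge1$ and, for all $k\ne l$, neither $\beta_k^0+\beta_l^0$ nor $\beta_k^0-\beta_l^0$ is a rational multiple of $\pi$, then $\tilde\theta_1^{(2)}\to{\theta_1^0}^{(2)}$ almost surely. -/

import Mathlib

open MeasureTheory ProbabilityTheory Filter Topology

/-- The sinusoid `A cos(α t) + B sin(α t)` with parameter vector `θ = (A, B, α)`. -/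
noncomputable def sinusoid (θ : ℝ × ℝ × ℝ) (t : ℕ) : ℝ :=
  θ.1 * Real.cos (θ.2.2 * t) + θ.2.1 * Real.sin (θ.2.2 * t)

/-- The chirp component `C cos(β t²) + D sin(β t²)` with parameter vector `θ = (C, D, β)`. -/
noncomputable def chirp (θ : ℝ × ℝ × ℝ) (t : ℕ) : ℝ :=
  θ.1 * Real.cos (θ.2.2 * (t : ℝ) ^ 2) + θ.2.1 * Real.sin (θ.2.2 * (t : ℝ) ^ 2)

/-- The squared amplitude of a component. -/
def sqAmplitude (θ : ℝ × ℝ × ℝ) : ℝ := θ.1 ^ 2 + θ.2.1 ^ 2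

/-- The set `K × K × [0, π]`; the parameter space of one component is the case `K = [-M, M]`. -/
def paramSpace (K : Set ℝ) : Set (ℝ × ℝ × ℝ) := K ×ˢ (K ×ˢ Set.Icc 0 Real.pi)

/-- The observations `y(t)` of the chirp-like model with `p` sinusoids, `q` chirp components and
additive noise `x`. -/
noncomputable def observation {p q : ℕ} (θs : Fin p → ℝ × ℝ × ℝ) (θc : Fin q → ℝ × ℝ × ℝ)
    (x : ℕ → ℝ) (t : ℕ) : ℝ :=
  ∑ j, sinusoid (θs j) t + ∑ k, chirp (θc k) t + x t

/-- `X` is the stationary linear process `X(t) = ∑_{j ∈ ℤ} a(j) e(t - j)`, where the `a(j)` are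
absolutely summable and the `e(t)` are i.i.d. with mean `0` and finite variance `σ²`. -/
structure IsLinearProcess {Ω : Type*} [MeasurableSpace Ω] (μ : Measure Ω) (X : ℤ → Ω → ℝ)
    (a : ℤ → ℝ) (e : ℤ → Ω → ℝ) (σ : ℝ) : Prop where
  summable_abs : Summable fun j => |a j|
  indep : iIndepFun e μ
  identDistrib : ∀ s t, IdentDistrib (e s) (e t) μ μ
  memLp : ∀ t, MemLp (e t) 2 μ
  mean_eq_zero : ∀ t, ∫ ω, e t ω ∂μ = 0
  variance_eq : ∀ t, variance (e t) μ = σ ^ 2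
  hasSum : ∀ t, ∀ᵐ ω ∂μ, HasSum (fun j => a j * e (t - j) ω) (X t ω)

/-- The error sum of squares of the data `y(1), …, y(n)` when the signal `g θ` is fitted. -/
def errorSumSq (g : ℝ × ℝ × ℝ → ℕ → ℝ) (n : ℕ) (y : ℕ → ℝ) (θ : ℝ × ℝ × ℝ) : ℝ :=
  ∑ t ∈ Finset.Icc 1 n, (y t - g θ t) ^ 2

/-- `θ` is a least squares estimate: it lies in `K × K × [0, π]` and minimises the error sum of
squares there. -/
def IsLeastSquares (g : ℝ × ℝ × ℝ → ℕ → ℝ) (K : Set ℝ) (n : ℕ) (y : ℕ → ℝ)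
    (θ : ℝ × ℝ × ℝ) : Prop :=
  θ ∈ paramSpace K ∧ ∀ θ' ∈ paramSpace K, errorSumSq g n y θ ≤ errorSumSq g n y θ'

/-- `(θs, θc)` are sequential least squares estimates from the data `y(1), …, y(n)`: the sinusoids
are fitted one after the other, each to the data from which the fitted earlier sinusoids have been
subtracted; then the chirp components are fitted in the same way to the data from which all fitted
sinusoids and the fitted earlier chirp components have been subtracted. -/
structure IsSequentialLSE {p q : ℕ} (K : Set ℝ) (n : ℕ) (y : ℕ → ℝ)
    (θs : Fin p → ℝ × ℝ × ℝ) (θc : Fin q → ℝ × ℝ × ℝ) : Prop where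
  sinusoid_step : ∀ j, IsLeastSquares sinusoid K n
    (fun t => y t - ∑ i ∈ Finset.Iio j, sinusoid (θs i) t) (θs j)
  chirp_step : ∀ k, IsLeastSquares chirp K n
    (fun t => y t - ∑ i, sinusoid (θs i) t - ∑ l ∈ Finset.Iio k, chirp (θc l) t) (θc k)

/-! Sinusoids and chirps are treated together as real parts of `c * exp(i β t ^ k)` with `k = 1, 2`,
seen as vectors with the norm of mean square over `t = 1, …, n`. Comparing the fit `G` with the
leading true component `G₀` gives `‖G - G₀‖² ≤ 2 ⟪Z + w + r, G - G₀⟫`, where `Z` collects the other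
components of the same kind, `w` the noise (and, while sinusoids are fitted, the chirps), and `r`
the error left by earlier fits. Consistency follows once the right side vanishes.

The set `K` may be unbounded, so the fitted amplitude is not bounded beforehand, and near the
frequencies `0` and `π` a component of large amplitude can have small norm. Correlations are
therefore bounded relative to `‖G‖`: `norm_cAmp_mul_min_le` limits the loss of norm, and Abel
summation in `abs_inner_vec_powHarmonic_le_of_partial_sums` treats the degenerate frequencies. Only
the frequency needs compactness, so along an ultrafilter it converges to some `b` in `[0, π]`.

If `b` resonates with a component other than `G₀`, separation of the frequencies makes it orthogonal
in the limit to all the rest, and the fit would gain at most that component's smaller energy; strict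
ordering of amplitudes excludes this. Hence `‖G - G₀‖ → 0` (`leastSquares_consistent`). The
parameters are then identified because an exponential mean of modulus near one forces its frequency
to within `o(n ^ (-k))` of a multiple of `2π` (`min_one_le_sqrt_one_sub_norm_phaseMean`).

The deterministic correlations vanish by geometric series and by Weyl differencing
(`eventually_forall_norm_sum_chirp_le`). For the noise, differencing gives bounds free of the
frequency; their means, computed with second moments only, are summable along `n = m ^ 8`, and the
gaps between eighth powers are filled directly (`IsLinearProcess.ae_decorrelates`). Induction over
the fitted sinusoids needs only mean-square convergence of the earlier fits. -/

/-! ### Exponential means of modulus close to one. -/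

/-- The unimodular sequence `t ↦ exp(i β t ^ k)`. -/
noncomputable def unitPhase (k : ℕ) (β : ℝ) (t : ℕ) : ℂ :=
  Complex.exp (Complex.I * ((β * (t : ℝ) ^ k : ℝ) : ℂ))

/-- The mean of `exp(i β t ^ k)` over `t = 1, …, n`. -/
noncomputable def phaseMean (k n : ℕ) (β : ℝ) : ℂ :=
  (∑ t ∈ Finset.Icc 1 n, unitPhase k β t) / n

@[simp] lemma norm_unitPhase (k : ℕ) (β : ℝ) (t : ℕ) : ‖unitPhase k β t‖ = 1 :=
  Complex.norm_exp_I_mul_ofReal _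

lemma unitPhase_mul (k : ℕ) (β γ : ℝ) (t : ℕ) :
    unitPhase k β t * unitPhase k γ t = unitPhase k (β + γ) t := by
  simp only [unitPhase, ← Complex.exp_add]
  congr 1; push_cast; ring

lemma conj_unitPhase (k : ℕ) (β : ℝ) (t : ℕ) :
    (starRingEnd ℂ) (unitPhase k β t) = unitPhase k (-β) t := by
  simp only [unitPhase, ← Complex.exp_conj]
  congr 1; simp

lemma norm_phaseMean_le_one (k n : ℕ) (β : ℝ) : ‖phaseMean k n β‖ ≤ 1 := by
  rw [phaseMean, norm_div, Complex.norm_natCast]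
  refine div_le_one_of_le₀ ((norm_sum_le _ _).trans ?_) (by positivity)
  simp

lemma sum_comp_le_sum_of_injective {f : ℕ → ℝ} (hf : ∀ t, 0 ≤ f t) {φ : ℕ → ℕ}
    (hφ : Function.Injective φ) {m n : ℕ} (hmn : ∀ t ∈ Finset.Icc 1 m, φ t ∈ Finset.Icc 1 n) :
    ∑ t ∈ Finset.Icc 1 m, f (φ t) ≤ ∑ t ∈ Finset.Icc 1 n, f t := by
  rw [← Finset.sum_image (f := f) (g := φ) (hφ.injOn)]
  refine Finset.sum_le_sum_of_subset_of_nonneg ?_ (fun _ _ _ => hf _)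
  intro x hx
  obtain ⟨t, ht, rfl⟩ := Finset.mem_image.1 hx
  exact hmn t ht

lemma exists_unit_conj_mul_eq_norm (z : ℂ) :
    ∃ c : ℂ, ‖c‖ = 1 ∧ ((starRingEnd ℂ) c * z).re = ‖z‖ := by
  by_cases hz : z = 0
  · exact ⟨1, by simp, by simp [hz]⟩
  · have h : ‖z‖ ≠ 0 := by simpa using hz
    refine ⟨z / ‖z‖, by simp [h], ?_⟩
    have : (starRingEnd ℂ) (z / ‖z‖) * z = ((‖z‖ : ℝ) : ℂ) := by
      rw [map_div₀, Complex.conj_ofReal, div_mul_eq_mul_div, mul_comm, Complex.mul_conj,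
        Complex.normSq_eq_norm_sq]
      have h' : (‖z‖ : ℂ) ≠ 0 := by exact_mod_cast h
      push_cast
      field_simp
    rw [this, Complex.ofReal_re]

/-- A sequence of unimodular numbers whose mean is nearly unimodular is nearly constant. -/
lemma exists_unit_sum_norm_sub_le (u : ℕ → ℂ) (hu : ∀ t, ‖u t‖ = 1) (n : ℕ) :
    ∃ c : ℂ, ‖c‖ = 1 ∧ ∑ t ∈ Finset.Icc 1 n, ‖u t - c‖ ≤
      n * √(2 * (1 - ‖(∑ t ∈ Finset.Icc 1 n, u t) / n‖)) := by
  obtain ⟨c, hc, hcs⟩ := exists_unit_conj_mul_eq_norm (∑ t ∈ Finset.Icc 1 n, u t)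
  refine ⟨c, hc, ?_⟩
  rcases Nat.eq_zero_or_pos n with rfl | hn
  · simp
  have hn' : (0 : ℝ) < n := by exact_mod_cast hn
  have h1 : ∑ t ∈ Finset.Icc 1 n, ‖u t - c‖ ^ 2 =
      n * (2 * (1 - ‖(∑ t ∈ Finset.Icc 1 n, u t) / n‖)) := by
    have : ∀ t, ‖u t - c‖ ^ 2 = 2 - 2 * ((starRingEnd ℂ) c * u t).re := by
      intro t
      have a1 : Complex.normSq (u t) = 1 := by rw [Complex.normSq_eq_norm_sq, hu]; simp
      have a2 : Complex.normSq c = 1 := by rw [Complex.normSq_eq_norm_sq, hc]; simp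
      rw [← Complex.normSq_eq_norm_sq, Complex.normSq_sub, a1, a2, mul_comm (u t)]; ring
    simp_rw [this]
    rw [Finset.sum_sub_distrib, ← Finset.mul_sum, ← Complex.re_sum, ← Finset.mul_sum, hcs,
      norm_div, Complex.norm_natCast]
    simp
    field_simp
  set x := 2 * (1 - ‖(∑ t ∈ Finset.Icc 1 n, u t) / n‖)
  have h2 : (∑ t ∈ Finset.Icc 1 n, ‖u t - c‖) ^ 2 ≤ (n : ℝ) ^ 2 * x := by
    refine (sq_sum_le_card_mul_sum_sq).trans ?_
    rw [h1, Nat.card_Icc, Nat.add_sub_cancel]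
    exact le_of_eq (by ring)
  calc ∑ t ∈ Finset.Icc 1 n, ‖u t - c‖ ≤ √((n : ℝ) ^ 2 * x) := Real.le_sqrt_of_sq_le h2
    _ = n * √x := by rw [Real.sqrt_mul (by positivity), Real.sqrt_sq hn'.le]

/-- The second-difference identity that linear and quadratic phases share. -/
lemma unitPhase_identity {k : ℕ} (hk : k = 1 ∨ k = 2) (β : ℝ) (t h : ℕ) :
    unitPhase k β h * unitPhase k β (2 * t + h) * unitPhase k β t ^ 2 =
      unitPhase k β (t + h) ^ 2 * unitPhase k β (2 * t) := by
  simp only [unitPhase, ← Complex.exp_add, ← Complex.exp_nat_mul]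
  congr 1
  rcases hk with rfl | rfl <;> push_cast <;> ring

lemma norm_mul_three_sub_pow_le {a b d c : ℂ} (ha : ‖a‖ = 1) (hb : ‖b‖ = 1) (hc : ‖c‖ = 1) :
    ‖a * b * d - c ^ 3‖ ≤ ‖a - c‖ + ‖b - c‖ + ‖d - c‖ := by
  have : a * b * d - c ^ 3 = a * b * (d - c) + a * c * (b - c) + c ^ 2 * (a - c) := by ring
  rw [this]
  refine (norm_add₃_le).trans ?_
  simp only [norm_mul, norm_pow, ha, hb, hc]
  linarith

/-- If most phases are near one constant `c`, the identity `unitPhase_identity` reads `u h * c ^ 3 ≈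
c ^ 3`, so `u h ≈ 1`. Averaging over `t ≤ m` turns "most" into a bound for every single `h ≤ m`. All
indices used are at most `3 * m ≤ n`; the constant is `6 * 8`, from six error terms and `n ≤ 8 * m`.
-/
lemma norm_unitPhase_sub_one_le {k : ℕ} (hk : k = 1 ∨ k = 2) (β : ℝ) {m n h : ℕ}
    (hmn : 3 * m ≤ n) (hnm : n ≤ 8 * m) (hm : 0 < m) (hh : h ≤ m) :
    ‖unitPhase k β h - 1‖ ≤ 48 * √(2 * (1 - ‖phaseMean k n β‖)) := by
  obtain ⟨c, hc, hsum⟩ := exists_unit_sum_norm_sub_le (unitPhase k β) (by simp) n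
  set u := unitPhase k β with hu
  have hu1 : ∀ t, ‖u t‖ = 1 := by simp [hu]
  set η := √(2 * (1 - ‖phaseMean k n β‖))
  change _ ≤ n * η at hsum
  have hη : 0 ≤ η := Real.sqrt_nonneg _
  have hpt : ∀ t, ‖u h - 1‖ ≤ 2 * ‖u (t + h) - c‖ + ‖u (2 * t) - c‖ + ‖u (2 * t + h) - c‖
      + 2 * ‖u t - c‖ := by
    intro t
    have e1 : ‖u h - 1‖ = ‖(u h - 1) * u (2 * t + h) * u t ^ 2‖ := by simp [hu1]
    have e2 : (u h - 1) * u (2 * t + h) * u t ^ 2 =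
        (u (t + h) * u (t + h) * u (2 * t) - c ^ 3) - (u t * u t * u (2 * t + h) - c ^ 3) := by
      have := unitPhase_identity hk β t h
      rw [← hu] at this
      linear_combination this
    rw [e1, e2]
    refine (norm_sub_le _ _).trans ?_
    have a1 := norm_mul_three_sub_pow_le (d := u (2 * t)) (hu1 (t + h)) (hu1 (t + h)) hc
    have a2 := norm_mul_three_sub_pow_le (d := u (2 * t + h)) (hu1 t) (hu1 t) hc
    linarith
  have hs : ∀ φ : ℕ → ℕ, Function.Injective φ → (∀ t ∈ Finset.Icc 1 m, φ t ∈ Finset.Icc 1 n) →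
      ∑ t ∈ Finset.Icc 1 m, ‖u (φ t) - c‖ ≤ n * η := fun φ h1 h2 =>
    (sum_comp_le_sum_of_injective (f := fun t => ‖u t - c‖) (fun _ => norm_nonneg _) h1 h2).trans
      hsum
  have s1 := hs (fun t => t + h) (fun a b hab => by simpa using hab) (fun t ht => by
    simp only [Finset.mem_Icc] at *; omega)
  have s2 := hs (fun t => 2 * t) (fun a b hab => by simpa using hab) (fun t ht => by
    simp only [Finset.mem_Icc] at *; omega)
  have s3 := hs (fun t => 2 * t + h) (fun a b hab => by simpa using hab) (fun t ht => by
    simp only [Finset.mem_Icc] at *; omega)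
  have s4 := hs (fun t => t) (fun a b hab => by simpa using hab) (fun t ht => by
    simp only [Finset.mem_Icc] at *; omega)
  have key : (m : ℝ) * ‖u h - 1‖ ≤ 6 * (n * η) := by
    calc (m : ℝ) * ‖u h - 1‖ = ∑ t ∈ Finset.Icc 1 m, ‖u h - 1‖ := by simp
      _ ≤ ∑ t ∈ Finset.Icc 1 m, (2 * ‖u (t + h) - c‖ + ‖u (2 * t) - c‖ + ‖u (2 * t + h) - c‖
          + 2 * ‖u t - c‖) := Finset.sum_le_sum fun t _ => hpt t
      _ ≤ _ := by
        simp only [Finset.sum_add_distrib, ← Finset.mul_sum]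
        linarith
  have hn8 : (n : ℝ) ≤ 8 * m := by exact_mod_cast hnm
  have hm' : (0 : ℝ) < m := by exact_mod_cast hm
  have : (m : ℝ) * ‖u h - 1‖ ≤ m * (48 * η) := by nlinarith
  exact le_of_mul_le_mul_left this hm'

lemma exists_reduced_phase (γ : ℝ) : ∃ (l : ℤ), |γ - l * (2 * Real.pi)| ≤ Real.pi := by
  refine ⟨round (γ / (2 * Real.pi)), ?_⟩
  have h := abs_sub_round (γ / (2 * Real.pi))
  have hpi := Real.pi_pos
  have : γ - round (γ / (2 * Real.pi)) * (2 * Real.pi) =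
      (γ / (2 * Real.pi) - round (γ / (2 * Real.pi))) * (2 * Real.pi) := by field_simp
  rw [this, abs_mul, abs_of_pos (by positivity : 0 < 2 * Real.pi)]
  nlinarith

lemma unitPhase_add_int_mul_two_pi (k : ℕ) (ψ : ℝ) (l : ℤ) (t : ℕ) :
    unitPhase k (ψ + l * (2 * Real.pi)) t = unitPhase k ψ t := by
  rw [unitPhase, unitPhase, Complex.exp_eq_exp_iff_exists_int]
  exact ⟨l * t ^ k, by push_cast; ring⟩

lemma abs_le_of_norm_exp_sub_one_le {x ε : ℝ} (hx : |x| ≤ Real.pi)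
    (h : ‖Complex.exp (Complex.I * x) - 1‖ ≤ ε) : |x| ≤ Real.pi / 2 * ε := by
  rw [Complex.norm_exp_I_mul_ofReal_sub_one] at h
  have h2 := Real.mul_abs_le_abs_sin (x := x / 2) (by rw [abs_div, abs_two]; linarith)
  rw [Real.norm_eq_abs, abs_mul, abs_two] at h
  rw [abs_div, abs_two] at h2
  have hpi := Real.pi_pos
  have : |x| = Real.pi / 2 * (2 * (2 / Real.pi * (|x| / 2))) := by field_simp
  rw [this]
  have : 2 * (2 / Real.pi * (|x| / 2)) ≤ ε := by linarith
  gcongr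

/-- A mean `phaseMean k n γ` of almost unit modulus forces `γ` to be within `o(n ^ (-k))` of a
multiple of `2π`. -/
lemma min_one_le_sqrt_one_sub_norm_phaseMean {k : ℕ} (hk : k = 1 ∨ k = 2) {n : ℕ} (hn : 4 ≤ n)
    (γ : ℝ) : min 1 ((n : ℝ) ^ k * |Real.sin (γ / 2)|) ≤
      10000 * √(2 * (1 - ‖phaseMean k n γ‖)) := by
  set η := √(2 * (1 - ‖phaseMean k n γ‖)) with hη
  have hη0 : 0 ≤ η := Real.sqrt_nonneg _
  by_cases hbig : 1 / 2 < 48 * η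
  · exact (min_le_left _ _).trans (by linarith)
  push Not at hbig
  refine (min_le_right _ _).trans ?_
  obtain ⟨m, hm, h3, h8⟩ : ∃ m, 0 < m ∧ 3 * m ≤ n ∧ n ≤ 8 * m :=
    ⟨n / 4, by omega, by omega, by omega⟩
  obtain ⟨l, hl⟩ := exists_reduced_phase γ
  set ψ := γ - l * (2 * Real.pi) with hψ
  have hγ : γ = ψ + l * (2 * Real.pi) := by rw [hψ]; ring
  have hpi := Real.pi_pos
  have hstep : ∀ h, h ≤ m → |ψ * (h : ℝ) ^ k| ≤ Real.pi → |ψ * (h : ℝ) ^ k| ≤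
      Real.pi / 2 * (48 * η) := by
    intro h hh hb
    refine abs_le_of_norm_exp_sub_one_le hb ?_
    have := norm_unitPhase_sub_one_le hk γ h3 h8 hm hh
    rwa [hγ, unitPhase_add_int_mul_two_pi, ← hγ] at this
  -- Continuity in `h` prevents wrapping around the circle: passing to `h + 1` multiplies the angle
  -- by at most `4`, and `48 * η ≤ 1 / 2` makes the bound `4 * (π / 2) * (48 * η)` at most `π`, so
  -- `hstep` applies again.
  have hind : ∀ h, 1 ≤ h → h ≤ m → |ψ * (h : ℝ) ^ k| ≤ Real.pi / 2 * (48 * η) := by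
    intro h h1
    induction h, h1 using Nat.le_induction with
    | base => intro h1; exact hstep 1 h1 (by simpa using hl)
    | succ h h1 ih =>
      intro h2
      refine hstep _ h2 ?_
      have := ih (by omega)
      have h1' : (1 : ℝ) ≤ h := by exact_mod_cast h1
      have h4 : ((h + 1 : ℕ) : ℝ) ^ k ≤ 4 * (h : ℝ) ^ k := by
        rcases hk with rfl | rfl <;> push_cast <;> nlinarith
      rw [abs_mul, abs_of_nonneg (by positivity : (0 : ℝ) ≤ ((h : ℕ) : ℝ) ^ k)] at this
      rw [abs_mul, abs_of_nonneg (by positivity : (0 : ℝ) ≤ ((h + 1 : ℕ) : ℝ) ^ k)]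
      calc |ψ| * ((h + 1 : ℕ) : ℝ) ^ k ≤ |ψ| * (4 * (h : ℝ) ^ k) := by gcongr
        _ ≤ 4 * (Real.pi / 2 * (48 * η)) := by linarith
        _ ≤ Real.pi := by nlinarith
  have hfin := hind m hm le_rfl
  rw [abs_mul, abs_of_nonneg (by positivity : (0 : ℝ) ≤ (m : ℝ) ^ k)] at hfin
  have hsin : |Real.sin (γ / 2)| ≤ |ψ| / 2 := by
    have : γ / 2 = ψ / 2 + l * Real.pi := by rw [hγ]; ring
    rw [this, Real.sin_add_int_mul_pi, abs_mul, abs_zpow, abs_neg, abs_one, one_zpow, one_mul]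
    calc _ ≤ |ψ / 2| := Real.abs_sin_le_abs
      _ = _ := by rw [abs_div, abs_two]
  have hnk : (n : ℝ) ^ k ≤ 64 * (m : ℝ) ^ k := by
    have hn8 : (n : ℝ) ≤ 8 * m := by exact_mod_cast h8
    have hm' : (0 : ℝ) ≤ m := by positivity
    rcases hk with rfl | rfl
    · nlinarith
    · calc (n : ℝ) ^ 2 ≤ (8 * m) ^ 2 := by gcongr
        _ = _ := by ring
  calc (n : ℝ) ^ k * |Real.sin (γ / 2)| ≤ (64 * (m : ℝ) ^ k) * (|ψ| / 2) := by gcongr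
    _ = 32 * (|ψ| * (m : ℝ) ^ k) := by ring
    _ ≤ 32 * (Real.pi / 2 * (48 * η)) := by gcongr
    _ ≤ 10000 * η := by nlinarith [Real.pi_lt_four]

/-! ### Components as vectors in mean square. -/

/-- The component `A cos(β t ^ k) + B sin(β t ^ k)`; `k = 1` is a sinusoid, `k = 2` a chirp. -/
noncomputable def powHarmonic (k : ℕ) (θ : ℝ × ℝ × ℝ) (t : ℕ) : ℝ :=
  θ.1 * Real.cos (θ.2.2 * (t : ℝ) ^ k) + θ.2.1 * Real.sin (θ.2.2 * (t : ℝ) ^ k)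

lemma sinusoid_eq_powHarmonic : sinusoid = powHarmonic 1 := by
  funext θ t; simp [sinusoid, powHarmonic]

lemma chirp_eq_powHarmonic : chirp = powHarmonic 2 := rfl

/-- The complex amplitude `A - i B`. -/
noncomputable def cAmp (θ : ℝ × ℝ × ℝ) : ℂ := ⟨θ.1, -θ.2.1⟩

lemma norm_cAmp_sq (θ : ℝ × ℝ × ℝ) : ‖cAmp θ‖ ^ 2 = sqAmplitude θ := by
  rw [← Complex.normSq_eq_norm_sq, Complex.normSq_apply]
  simp [cAmp, sqAmplitude]; ring

lemma unitPhase_re (k : ℕ) (β : ℝ) (t : ℕ) : (unitPhase k β t).re = Real.cos (β * (t : ℝ) ^ k) := by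
  rw [unitPhase, mul_comm, Complex.exp_ofReal_mul_I_re]

lemma unitPhase_im (k : ℕ) (β : ℝ) (t : ℕ) : (unitPhase k β t).im = Real.sin (β * (t : ℝ) ^ k) := by
  rw [unitPhase, mul_comm, Complex.exp_ofReal_mul_I_im]

lemma powHarmonic_eq_re (k : ℕ) (θ : ℝ × ℝ × ℝ) (t : ℕ) :
    powHarmonic k θ t = (cAmp θ * unitPhase k θ.2.2 t).re := by
  rw [Complex.mul_re, unitPhase_re, unitPhase_im]
  simp [powHarmonic, cAmp]

lemma ofReal_re_eq (z : ℂ) : ((z.re : ℝ) : ℂ) = (z + (starRingEnd ℂ) z) / 2 := by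
  rw [Complex.add_conj]; push_cast; ring

lemma abs_powHarmonic_le (k : ℕ) (θ : ℝ × ℝ × ℝ) (t : ℕ) : |powHarmonic k θ t| ≤ ‖cAmp θ‖ := by
  rw [powHarmonic_eq_re]
  refine (Complex.abs_re_le_norm _).trans ?_
  simp

lemma powHarmonic_mul_powHarmonic (k : ℕ) (θ θ' : ℝ × ℝ × ℝ) (t : ℕ) :
    powHarmonic k θ t * powHarmonic k θ' t =
      (cAmp θ * cAmp θ' * unitPhase k (θ.2.2 + θ'.2.2) t).re / 2 +
      (cAmp θ * (starRingEnd ℂ) (cAmp θ') * unitPhase k (θ.2.2 - θ'.2.2) t).re / 2 := by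
  rw [powHarmonic_eq_re, powHarmonic_eq_re, sub_eq_add_neg, ← unitPhase_mul, ← unitPhase_mul,
    ← conj_unitPhase]
  simp only [Complex.mul_re, Complex.mul_im, Complex.conj_re, Complex.conj_im]
  ring

/-- The vector `(x 1, …, x n) / √n`. -/
noncomputable def vec (n : ℕ) : (ℕ → ℝ) →ₗ[ℝ] EuclideanSpace ℝ (Finset.Icc 1 n) where
  toFun x := WithLp.toLp 2 fun t => x t / √n
  map_add' x y := by ext t; simp [add_div]
  map_smul' c x := by ext t; simp [mul_div_assoc]

lemma inner_vec (n : ℕ) (x y : ℕ → ℝ) :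
    inner ℝ (vec n x) (vec n y) = (∑ t ∈ Finset.Icc 1 n, x t * y t) / n := by
  rw [PiLp.inner_apply, Finset.sum_div, ← Finset.sum_coe_sort (Finset.Icc 1 n)]
  refine Finset.sum_congr rfl fun t _ => ?_
  have : √(n : ℝ) * √(n : ℝ) = n := Real.mul_self_sqrt (Nat.cast_nonneg n)
  simp only [vec, LinearMap.coe_mk, AddHom.coe_mk, RCLike.inner_apply, conj_trivial]
  rw [div_mul_div_comm, this, mul_comm]

lemma norm_vec_sq (n : ℕ) (x : ℕ → ℝ) :
    ‖vec n x‖ ^ 2 = (∑ t ∈ Finset.Icc 1 n, x t ^ 2) / n := by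
  rw [← real_inner_self_eq_norm_sq, inner_vec]; simp [sq]

lemma norm_vec_le {n : ℕ} {x : ℕ → ℝ} {c : ℝ} (hc : 0 ≤ c) (hx : ∀ t ∈ Finset.Icc 1 n, |x t| ≤ c) :
    ‖vec n x‖ ≤ c := by
  refine le_of_sq_le_sq ?_ hc
  rw [norm_vec_sq]
  rcases Nat.eq_zero_or_pos n with rfl | hn
  · simp; positivity
  have hn' : (0 : ℝ) < n := by exact_mod_cast hn
  rw [div_le_iff₀ hn']
  calc ∑ t ∈ Finset.Icc 1 n, x t ^ 2 ≤ ∑ t ∈ Finset.Icc 1 n, c ^ 2 :=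
        Finset.sum_le_sum fun t ht => sq_le_sq' (abs_le.1 (hx t ht)).1 (abs_le.1 (hx t ht)).2
    _ = c ^ 2 * n := by simp [mul_comm]

lemma exists_abs_le_norm_vec {n : ℕ} (hn : 1 ≤ n) (x : ℕ → ℝ) :
    ∃ t ∈ Finset.Icc 1 n, |x t| ≤ ‖vec n x‖ := by
  have hn' : (0 : ℝ) < n := by exact_mod_cast hn
  obtain ⟨t, ht, h⟩ := Finset.exists_le_of_sum_le (s := Finset.Icc 1 n)
    (f := fun t => x t ^ 2) (g := fun _ => ‖vec n x‖ ^ 2) ⟨1, by simp [hn]⟩ (by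
      rw [norm_vec_sq]; simp; field_simp; exact le_rfl)
  exact ⟨t, ht, abs_le_of_sq_le_sq h (norm_nonneg _)⟩

lemma sum_mul_unitPhase_re_div (k n : ℕ) (z : ℂ) (β : ℝ) :
    (∑ t ∈ Finset.Icc 1 n, (z * unitPhase k β t).re / 2) / n = (z * phaseMean k n β).re / 2 := by
  rw [← Finset.sum_div, ← Complex.re_sum, ← Finset.mul_sum, phaseMean, ← mul_div_assoc,
    Complex.div_natCast_re]
  ring

lemma inner_vec_powHarmonic (k n : ℕ) (θ θ' : ℝ × ℝ × ℝ) :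
    inner ℝ (vec n (powHarmonic k θ)) (vec n (powHarmonic k θ')) =
      (cAmp θ * cAmp θ' * phaseMean k n (θ.2.2 + θ'.2.2)).re / 2 +
      (cAmp θ * (starRingEnd ℂ) (cAmp θ') * phaseMean k n (θ.2.2 - θ'.2.2)).re / 2 := by
  rw [inner_vec]
  simp_rw [powHarmonic_mul_powHarmonic, Finset.sum_add_distrib, add_div, sum_mul_unitPhase_re_div]

lemma abs_inner_vec_powHarmonic_le (k n : ℕ) (θ θ' : ℝ × ℝ × ℝ) :
    |inner ℝ (vec n (powHarmonic k θ)) (vec n (powHarmonic k θ'))| ≤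
      ‖cAmp θ‖ * ‖cAmp θ'‖ / 2 *
        (‖phaseMean k n (θ.2.2 + θ'.2.2)‖ + ‖phaseMean k n (θ.2.2 - θ'.2.2)‖) := by
  rw [inner_vec_powHarmonic]
  refine (abs_add_le _ _).trans ?_
  rw [abs_div, abs_div, abs_two]
  have h1 := Complex.abs_re_le_norm (cAmp θ * cAmp θ' * phaseMean k n (θ.2.2 + θ'.2.2))
  have h2 := Complex.abs_re_le_norm
    (cAmp θ * (starRingEnd ℂ) (cAmp θ') * phaseMean k n (θ.2.2 - θ'.2.2))
  simp only [norm_mul, RCLike.norm_conj] at h1 h2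
  linarith

lemma phaseMean_zero (k : ℕ) {n : ℕ} (hn : 1 ≤ n) : phaseMean k n 0 = 1 := by
  have : (n : ℂ) ≠ 0 := by exact_mod_cast (by omega : n ≠ 0)
  simp [phaseMean, unitPhase, this]

lemma abs_norm_vec_powHarmonic_sq_sub_le (k : ℕ) {n : ℕ} (hn : 1 ≤ n) (θ : ℝ × ℝ × ℝ) :
    |‖vec n (powHarmonic k θ)‖ ^ 2 - sqAmplitude θ / 2| ≤
      sqAmplitude θ / 2 * ‖phaseMean k n (2 * θ.2.2)‖ := by
  rw [← real_inner_self_eq_norm_sq, inner_vec_powHarmonic, sub_self, phaseMean_zero k hn,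
    Complex.mul_conj, Complex.normSq_eq_norm_sq, norm_cAmp_sq, mul_one, Complex.ofReal_re,
    add_sub_cancel_right, abs_div, abs_two, ← two_mul]
  have h1 := Complex.abs_re_le_norm (cAmp θ * cAmp θ * phaseMean k n (2 * θ.2.2))
  simp only [norm_mul] at h1
  rw [← norm_cAmp_sq]
  linarith

/-- The mean square is at least half the squared amplitude times `1 - ‖phaseMean k n (2 * β)‖`, and
a phase mean at `2 * β` can be near modulus one only if `n ^ k * |sin β|` is small. This limits how
large an amplitude can hide in a vector of small norm. -/
lemma norm_cAmp_mul_min_le {k : ℕ} (hk : k = 1 ∨ k = 2) {n : ℕ} (hn : 4 ≤ n) (θ : ℝ × ℝ × ℝ) :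
    ‖cAmp θ‖ * min 1 ((n : ℝ) ^ k * |Real.sin θ.2.2|) ≤ 20000 * ‖vec n (powHarmonic k θ)‖ := by
  have h1 := min_one_le_sqrt_one_sub_norm_phaseMean hk hn (2 * θ.2.2)
  rw [mul_div_cancel_left₀ _ (two_ne_zero)] at h1
  have h2 := (abs_le.1 (abs_norm_vec_powHarmonic_sq_sub_le k (by omega : 1 ≤ n) θ)).1
  have h3 : ‖cAmp θ‖ * √(2 * (1 - ‖phaseMean k n (2 * θ.2.2)‖)) ≤ 2 * ‖vec n (powHarmonic k θ)‖ := by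
    refine le_of_sq_le_sq ?_ (by positivity)
    rw [mul_pow, Real.sq_sqrt (by linarith [norm_phaseMean_le_one k n (2 * θ.2.2)]), norm_cAmp_sq]
    nlinarith
  calc _ ≤ ‖cAmp θ‖ * (10000 * √(2 * (1 - ‖phaseMean k n (2 * θ.2.2)‖))) := by gcongr
    _ ≤ _ := by linarith

/-! ### Correlations relative to the norm of the fitted component. -/

/-- Summation by parts: the cost of a factor `b` is its last value plus its total variation. -/
lemma norm_sum_mul_le_of_partial_sums {a b : ℕ → ℂ} {n : ℕ} {D : ℝ} (hn : 1 ≤ n)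
    (ha : ∀ m ≤ n, ‖∑ t ∈ Finset.Icc 1 m, a t‖ ≤ D) :
    ‖∑ t ∈ Finset.Icc 1 n, a t * b t‖ ≤
      D * (‖b n‖ + ∑ t ∈ Finset.Ico 1 n, ‖b (t + 1) - b t‖) := by
  have key : ∀ n, 1 ≤ n → ∑ t ∈ Finset.Icc 1 n, a t * b t =
      (∑ t ∈ Finset.Icc 1 n, a t) * b n -
        ∑ t ∈ Finset.Ico 1 n, (∑ s ∈ Finset.Icc 1 t, a s) * (b (t + 1) - b t) := by
    intro n hn
    induction n, hn using Nat.le_induction with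
    | base => simp
    | succ n hn ih =>
      rw [Finset.sum_Icc_succ_top (by omega), ih, Finset.sum_Icc_succ_top (by omega),
        Finset.sum_Ico_succ_top hn]
      ring
  rw [key n hn, mul_add]
  refine (norm_sub_le _ _).trans (add_le_add ?_ ?_)
  · rw [norm_mul]; gcongr; exact ha n le_rfl
  · rw [Finset.mul_sum]
    refine (norm_sum_le _ _).trans (Finset.sum_le_sum fun t ht => ?_)
    rw [norm_mul]; gcongr; exact ha t (Finset.mem_Ico.1 ht).2.le

lemma abs_sin_nat_mul_le (m : ℕ) (x : ℝ) : |Real.sin (m * x)| ≤ m * |Real.sin x| := by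
  induction m with
  | zero => simp
  | succ m ih =>
    push_cast
    rw [add_mul, one_mul, Real.sin_add]
    refine (abs_add_le _ _).trans ?_
    rw [abs_mul, abs_mul, add_mul, one_mul]
    have h1 := Real.abs_cos_le_one x
    have h2 := Real.abs_cos_le_one (m * x)
    have := abs_nonneg (Real.sin (m * x))
    have := abs_nonneg (Real.sin x)
    nlinarith

/-- The slowly varying factor `g(t) exp(-i β t ^ k)` of a component `g` with frequency `β`. -/
noncomputable def demodulated (k : ℕ) (θ : ℝ × ℝ × ℝ) (t : ℕ) : ℂ :=
  (cAmp θ + (starRingEnd ℂ) (cAmp θ) * unitPhase k (-2 * θ.2.2) t) / 2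

lemma unitPhase_mul_demodulated (k : ℕ) (θ : ℝ × ℝ × ℝ) (t : ℕ) :
    unitPhase k θ.2.2 t * demodulated k θ t = powHarmonic k θ t := by
  rw [powHarmonic_eq_re, ofReal_re_eq, map_mul, conj_unitPhase, demodulated,
    show (-θ.2.2) = θ.2.2 + -2 * θ.2.2 by ring, ← unitPhase_mul]
  ring

lemma norm_demodulated (k : ℕ) (θ : ℝ × ℝ × ℝ) (t : ℕ) :
    ‖demodulated k θ t‖ = |powHarmonic k θ t| := by
  rw [← Real.norm_eq_abs, ← Complex.norm_real, ← unitPhase_mul_demodulated, norm_mul,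
    norm_unitPhase, one_mul]

lemma norm_demodulated_succ_sub_le (k : ℕ) (θ : ℝ × ℝ × ℝ) (t : ℕ) :
    ‖demodulated k θ (t + 1) - demodulated k θ t‖ ≤
      ‖cAmp θ‖ * |Real.sin θ.2.2| * (((t + 1 : ℕ) : ℝ) ^ k - (t : ℝ) ^ k) := by
  have hle : t ^ k ≤ (t + 1) ^ k := Nat.pow_le_pow_left (by omega) k
  have h1 : unitPhase k (-2 * θ.2.2) (t + 1) = unitPhase k (-2 * θ.2.2) t *
      Complex.exp (Complex.I * ((-2 * θ.2.2 * (((t + 1) ^ k - t ^ k : ℕ) : ℝ) : ℝ) : ℂ)) := by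
    rw [unitPhase, unitPhase, ← Complex.exp_add]
    congr 1
    rw [Nat.cast_sub hle]; push_cast; ring
  have h2 : demodulated k θ (t + 1) - demodulated k θ t = (starRingEnd ℂ) (cAmp θ) / 2 *
      (unitPhase k (-2 * θ.2.2) t * (Complex.exp (Complex.I *
        ((-2 * θ.2.2 * (((t + 1) ^ k - t ^ k : ℕ) : ℝ) : ℝ) : ℂ)) - 1)) := by
    rw [demodulated, demodulated, h1]; ring
  rw [h2]
  simp only [norm_mul, norm_div, RCLike.norm_conj, norm_unitPhase,
    Complex.norm_exp_I_mul_ofReal_sub_one, Real.norm_eq_abs]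
  have h3 := abs_sin_nat_mul_le ((t + 1) ^ k - t ^ k) θ.2.2
  rw [show -2 * θ.2.2 * (((t + 1) ^ k - t ^ k : ℕ) : ℝ) / 2 =
    -((((t + 1) ^ k - t ^ k : ℕ) : ℝ) * θ.2.2) by ring, Real.sin_neg, abs_neg]
  rw [Nat.cast_sub hle] at *
  push_cast at *
  have : 0 ≤ ‖cAmp θ‖ := norm_nonneg _
  rw [abs_two, Complex.norm_two]
  nlinarith

/-- The bound involves the norm of the component, not its amplitude, so it survives unbounded
amplitudes. Away from degeneracy the amplitude is bounded by a multiple of the norm. Near degeneracy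
the component is `exp(i β t ^ k)` times a slowly varying factor, and Abel summation applies. -/
lemma abs_inner_vec_powHarmonic_le_of_partial_sums {k : ℕ} (hk : k = 1 ∨ k = 2) {n : ℕ} (hn : 4 ≤ n)
    {w : ℕ → ℝ} {θ : ℝ × ℝ × ℝ} {ε : ℝ}
    (hw : ∀ m ≤ n, ‖∑ t ∈ Finset.Icc 1 m, (w t : ℂ) * unitPhase k θ.2.2 t‖ ≤ ε * n) :
    |inner ℝ (vec n w) (vec n (powHarmonic k θ))| ≤ 50000 * ε * ‖vec n (powHarmonic k θ)‖ := by
  have hn' : (0 : ℝ) < n := by exact_mod_cast (by omega : 0 < n)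
  have hε : 0 ≤ ε := by
    have := (norm_nonneg _).trans (hw n le_rfl)
    exact nonneg_of_mul_nonneg_left this hn'
  have hmin := norm_cAmp_mul_min_le hk hn θ
  set N := ‖vec n (powHarmonic k θ)‖ with hN
  have hN0 : 0 ≤ N := norm_nonneg _
  have hR : 0 ≤ ‖cAmp θ‖ := norm_nonneg _
  rw [inner_vec, abs_div, Nat.abs_cast, div_le_iff₀ hn']
  rcases le_total 1 ((n : ℝ) ^ k * |Real.sin θ.2.2|) with h | h
  · rw [min_eq_left h, mul_one] at hmin
    have : (∑ t ∈ Finset.Icc 1 n, w t * powHarmonic k θ t) =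
        (cAmp θ * ∑ t ∈ Finset.Icc 1 n, (w t : ℂ) * unitPhase k θ.2.2 t).re := by
      rw [Finset.mul_sum, Complex.re_sum]
      refine Finset.sum_congr rfl fun t _ => ?_
      rw [powHarmonic_eq_re, ← Complex.re_ofReal_mul]
      congr 1; ring
    rw [this]
    refine (Complex.abs_re_le_norm _).trans ?_
    rw [norm_mul]
    calc _ ≤ (20000 * N) * (ε * n) := by gcongr; exact hw n le_rfl
      _ ≤ 50000 * ε * N * n := by
        have : 0 ≤ N * (ε * n) := by positivity
        nlinarith
  · rw [min_eq_right h] at hmin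
    -- The increments telescope to `‖cAmp θ‖ * |sin β| * (m ^ k - l ^ k)`, which the degenerate case
    -- of `hmin` bounds by the norm.
    have htv : ∀ l m, 1 ≤ l → l ≤ m → m ≤ n →
        ∑ t ∈ Finset.Ico l m, ‖demodulated k θ (t + 1) - demodulated k θ t‖ ≤ 20000 * N := by
      intro l m _ hlm hmn
      refine (Finset.sum_le_sum fun t _ => norm_demodulated_succ_sub_le k θ t).trans ?_
      rw [← Finset.mul_sum, Finset.sum_Ico_sub (fun t : ℕ => (t : ℝ) ^ k) hlm]
      refine le_trans ?_ hmin
      have h1 : (m : ℝ) ^ k ≤ (n : ℝ) ^ k := by gcongr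
      have h2 : 0 ≤ (l : ℝ) ^ k := by positivity
      have h3 : 0 ≤ ‖cAmp θ‖ * |Real.sin θ.2.2| := by positivity
      nlinarith
    -- Some value is at most the root mean square; the variation carries this bound to the endpoint.
    have hlast : ‖demodulated k θ n‖ ≤ N + 20000 * N := by
      obtain ⟨s, hs, hsN⟩ := exists_abs_le_norm_vec (by omega : 1 ≤ n) (powHarmonic k θ)
      rw [← norm_demodulated] at hsN
      rw [Finset.mem_Icc] at hs
      have h1 := htv s n hs.1 hs.2 le_rfl
      have h2 : ‖demodulated k θ n - demodulated k θ s‖ ≤ 20000 * N := by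
        rw [← Finset.sum_Ico_sub (demodulated k θ) hs.2]
        exact (norm_sum_le _ _).trans h1
      have := norm_sub_norm_le (demodulated k θ n) (demodulated k θ s)
      linarith
    have habel := norm_sum_mul_le_of_partial_sums (b := demodulated k θ) (by omega : 1 ≤ n) hw
    have : ‖∑ t ∈ Finset.Icc 1 n, (w t : ℂ) * unitPhase k θ.2.2 t * demodulated k θ t‖ =
        |∑ t ∈ Finset.Icc 1 n, w t * powHarmonic k θ t| := by
      rw [← Real.norm_eq_abs, ← Complex.norm_real]
      push_cast
      congr 1
      refine Finset.sum_congr rfl fun t _ => ?_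
      rw [mul_assoc, unitPhase_mul_demodulated]
    rw [← this]
    refine habel.trans ?_
    have h1 := htv 1 n le_rfl (by omega) le_rfl
    calc _ ≤ ε * n * ((N + 20000 * N) + 20000 * N) := by gcongr
      _ ≤ 50000 * ε * N * n := by
        have : 0 ≤ N * (ε * n) := by positivity
        nlinarith

/-- The means of `w(t) exp(i β t ^ k)` vanish in the limit, locally uniformly at `β`. -/
def Decorrelates (k : ℕ) (w : ℕ → ℝ) (β : ℝ) : Prop :=
  Tendsto (fun p : ℕ × ℝ => (∑ t ∈ Finset.Icc 1 p.1, (w t : ℂ) * unitPhase k p.2 t) / (p.1 : ℂ))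
    (atTop ×ˢ 𝓝 β) (𝓝 0)

/-- The filter `F` is arbitrary below `atTop` so that this applies along ultrafilters on which the
fitted frequency converges; no bound on the fitted amplitude is needed. -/
lemma Decorrelates.eventually_abs_inner_le {k : ℕ} (hk : k = 1 ∨ k = 2) {w : ℕ → ℝ} {β : ℝ}
    (hw : Decorrelates k w β) {F : Filter ℕ} (hF : F ≤ atTop) {θ : ℕ → ℝ × ℝ × ℝ}
    (hθ : Tendsto (fun n => (θ n).2.2) F (𝓝 β)) {ε : ℝ} (hε : 0 < ε) :
    ∀ᶠ n in F, |inner ℝ (vec n w) (vec n (powHarmonic k (θ n)))| ≤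
      ε * ‖vec n (powHarmonic k (θ n))‖ := by
  obtain ⟨δ, hδ, hδε⟩ : ∃ δ : ℝ, 0 < δ ∧ 50000 * δ = ε := ⟨ε / 50000, by positivity, by ring⟩
  have h1 := (Metric.tendsto_nhds.1 hw) δ hδ
  obtain ⟨pa, ha, pb, hb, hab⟩ := Filter.eventually_prod_iff.1 h1
  obtain ⟨N, hN⟩ := eventually_atTop.1 ha
  have h2 : ∀ᶠ n : ℕ in atTop, ∑ t ∈ Finset.Icc 1 N, |w t| ≤ δ * n := by
    have : Tendsto (fun n : ℕ => δ * (n : ℝ)) atTop atTop :=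
      tendsto_natCast_atTop_atTop.const_mul_atTop hδ
    exact this.eventually_ge_atTop _
  filter_upwards [hθ.eventually hb, hF h2, hF (eventually_ge_atTop 4)] with n hn1 hn2 hn3
  rw [← hδε]
  refine abs_inner_vec_powHarmonic_le_of_partial_sums hk hn3 fun m hm => ?_
  -- Long partial sums are small by decorrelation; those of length at most `N` are bounded trivially
  -- by a fixed number, hence by `δ * n` for large `n`.
  rcases le_total N m with h | h
  · have := hab (hN m h) hn1
    rw [dist_zero_right, norm_div, Complex.norm_natCast] at this
    rcases Nat.eq_zero_or_pos m with rfl | hm0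
    · simp; positivity
    have hm' : (0 : ℝ) < m := by exact_mod_cast hm0
    rw [div_lt_iff₀ hm'] at this
    refine this.le.trans ?_
    gcongr
  · refine le_trans ?_ hn2
    refine (norm_sum_le _ _).trans ?_
    simp only [norm_mul, norm_unitPhase, mul_one, Complex.norm_real, Real.norm_eq_abs]
    exact Finset.sum_le_sum_of_subset_of_nonneg (Finset.Icc_subset_Icc_right h)
      (fun _ _ _ => abs_nonneg _)

lemma norm_sum_pow_le {z : ℂ} (hz : ‖z‖ = 1) (h1 : z ≠ 1) (n : ℕ) :
    ‖∑ t ∈ Finset.Icc 1 n, z ^ t‖ ≤ 2 / ‖z - 1‖ := by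
  have h : (∑ t ∈ Finset.Icc 1 n, z ^ t) * (z - 1) = z ^ (n + 1) - z := by
    induction n with
    | zero => simp
    | succ n ih => rw [Finset.sum_Icc_succ_top (by omega), add_mul, ih]; ring
  rw [le_div_iff₀ (norm_pos_iff.2 (sub_ne_zero.2 h1)), ← norm_mul, h]
  refine (norm_sub_le _ _).trans ?_
  simp [hz]; norm_num

/-! ### Vanishing exponential means and decorrelation. -/

/-- The means of `exp(i γ t ^ k)` vanish in the limit, locally uniformly at `γ`. -/
def PhaseVanishes (k : ℕ) (γ : ℝ) : Prop :=
  Tendsto (fun p : ℕ × ℝ => phaseMean k p.1 p.2) (atTop ×ˢ 𝓝 γ) (𝓝 0)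

lemma PhaseVanishes.tendsto_add_right {k : ℕ} {β c : ℝ} (h : PhaseVanishes k (β + c)) :
    Tendsto (fun p : ℕ × ℝ => phaseMean k p.1 (p.2 + c)) (atTop ×ˢ 𝓝 β) (𝓝 0) := by
  have h1 : Tendsto (fun p : ℕ × ℝ => p.2 + c) (atTop ×ˢ 𝓝 β) (𝓝 (β + c)) :=
    Tendsto.add_const c tendsto_snd
  have h2 : Tendsto (fun p : ℕ × ℝ => (p.1, p.2 + c)) (atTop ×ˢ 𝓝 β) (atTop ×ˢ 𝓝 (β + c)) :=
    tendsto_fst.prodMk h1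
  unfold PhaseVanishes at h
  have h3 := h.comp h2
  exact h3

lemma PhaseVanishes.tendsto_of_le {k : ℕ} {γ : ℝ} (h : PhaseVanishes k γ) {F : Filter ℕ}
    (hF : F ≤ atTop) {g : ℕ → ℝ} (hg : Tendsto g F (𝓝 γ)) :
    Tendsto (fun n => ‖phaseMean k n (g n)‖) F (𝓝 0) := by
  have := (h.comp ((tendsto_id'.2 hF).prodMk hg)).norm
  simpa using this

lemma not_phaseVanishes_zero (k : ℕ) : ¬ PhaseVanishes k 0 := by
  intro h
  have h1 := h.tendsto_of_le le_rfl (tendsto_const_nhds (x := (0 : ℝ)))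
  have h2 : (fun n : ℕ => ‖phaseMean k n 0‖) =ᶠ[atTop] fun _ => (1 : ℝ) := by
    filter_upwards [eventually_ge_atTop 1] with n hn
    rw [phaseMean_zero k hn, norm_one]
  exact zero_ne_one (tendsto_nhds_unique h1 (tendsto_const_nhds.congr' h2.symm))

lemma powHarmonic_eq_add (k : ℕ) (θ : ℝ × ℝ × ℝ) (t : ℕ) :
    (powHarmonic k θ t : ℂ) = cAmp θ / 2 * unitPhase k θ.2.2 t +
      (starRingEnd ℂ) (cAmp θ) / 2 * unitPhase k (-θ.2.2) t := by
  rw [powHarmonic_eq_re, ofReal_re_eq, map_mul, conj_unitPhase]; ring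

lemma decorrelates_powHarmonic {k : ℕ} {θ : ℝ × ℝ × ℝ} {β : ℝ} (h1 : PhaseVanishes k (β + θ.2.2))
    (h2 : PhaseVanishes k (β - θ.2.2)) : Decorrelates k (powHarmonic k θ) β := by
  have e : (fun p : ℕ × ℝ => (∑ t ∈ Finset.Icc 1 p.1,
      (powHarmonic k θ t : ℂ) * unitPhase k p.2 t) / (p.1 : ℂ)) = fun p =>
      cAmp θ / 2 * phaseMean k p.1 (p.2 + θ.2.2) +
        (starRingEnd ℂ) (cAmp θ) / 2 * phaseMean k p.1 (p.2 + -θ.2.2) := by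
    funext p
    simp only [phaseMean, ← mul_div_assoc, ← add_div, Finset.mul_sum, ← Finset.sum_add_distrib]
    congr 1
    refine Finset.sum_congr rfl fun t _ => ?_
    rw [powHarmonic_eq_add, ← unitPhase_mul, ← unitPhase_mul]; ring
  rw [Decorrelates, e]
  rw [sub_eq_add_neg] at h2
  simpa using (h1.tendsto_add_right.const_mul (cAmp θ / 2)).add
    (h2.tendsto_add_right.const_mul ((starRingEnd ℂ) (cAmp θ) / 2))

lemma Decorrelates.add {k : ℕ} {w w' : ℕ → ℝ} {β : ℝ} (h : Decorrelates k w β)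
    (h' : Decorrelates k w' β) : Decorrelates k (fun t => w t + w' t) β := by
  have := Tendsto.add h h'
  rw [add_zero] at this
  refine this.congr fun p => ?_
  rw [← add_div, ← Finset.sum_add_distrib]
  simp [add_mul]

lemma Decorrelates.sum {ι : Type*} {k : ℕ} {w : ι → ℕ → ℝ} {β : ℝ} (s : Finset ι)
    (h : ∀ i ∈ s, Decorrelates k (w i) β) : Decorrelates k (fun t => ∑ i ∈ s, w i t) β := by
  classical
  induction s using Finset.induction_on with
  | empty => simp [Decorrelates]
  | insert i s hi ih =>
    simp only [Finset.sum_insert hi]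
    exact (h i (by simp)).add (ih fun j hj => h j (by simp [hj]))

/-- The geometric sum is at most `2 / ‖exp(iγ) - 1‖`, which stays bounded near a `γ` where the
denominator is nonzero. -/
lemma phaseVanishes_one {γ : ℝ} (hγ : Complex.exp (Complex.I * γ) ≠ 1) : PhaseVanishes 1 γ := by
  have hb : Tendsto (fun p : ℕ × ℝ => ((p.1 : ℝ))⁻¹ * (2 / ‖Complex.exp (Complex.I * p.2) - 1‖))
      (atTop ×ˢ 𝓝 γ) (𝓝 0) := by
    have h1 : Tendsto (fun x : ℝ => 2 / ‖Complex.exp (Complex.I * x) - 1‖) (𝓝 γ)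
        (𝓝 (2 / ‖Complex.exp (Complex.I * γ) - 1‖)) := by
      refine tendsto_const_nhds.div ?_ (norm_ne_zero_iff.2 (sub_ne_zero.2 hγ))
      exact (by fun_prop : Continuous fun x : ℝ => ‖Complex.exp (Complex.I * x) - 1‖).tendsto γ
    simpa using (tendsto_inv_atTop_nhds_zero_nat (𝕜 := ℝ)).comp tendsto_fst |>.mul
      (h1.comp (tendsto_snd (f := (atTop : Filter ℕ))))
  have hne : ∀ᶠ p : ℕ × ℝ in atTop ×ˢ 𝓝 γ, Complex.exp (Complex.I * p.2) ≠ 1 := by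
    have : ∀ᶠ x : ℝ in 𝓝 γ, Complex.exp (Complex.I * x) ≠ 1 :=
      (by fun_prop : Continuous fun x : ℝ => Complex.exp (Complex.I * x)).continuousAt.eventually_ne
        hγ
    exact tendsto_snd.eventually this
  refine squeeze_zero_norm' ?_ hb
  filter_upwards [hne] with p hp
  rw [phaseMean, norm_div, Complex.norm_natCast, div_eq_inv_mul]
  gcongr
  have : ∀ t, unitPhase 1 p.2 t = Complex.exp (Complex.I * p.2) ^ t := by
    intro t; rw [unitPhase, ← Complex.exp_nat_mul]; congr 1; push_cast; ring
  simp_rw [this]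
  exact norm_sum_pow_le (Complex.norm_exp_I_mul_ofReal _) hp _

/-! ### Van der Corput differencing and Weyl sums. -/

/-- Van der Corput's inequality. -/
lemma van_der_corput {v : ℕ → ℂ} (hv : ∀ t, ‖v t‖ = 1) {n H : ℕ} {B : ℝ} (hB0 : 0 ≤ B)
    (hB : ∀ h ∈ Finset.range H, ∀ h' ∈ Finset.range H, h ≠ h' →
      ‖∑ t ∈ Finset.Icc 1 n, v (t + h) * (starRingEnd ℂ) (v (t + h'))‖ ≤ B) :
    H * ‖∑ t ∈ Finset.Icc 1 n, v t‖ ≤ 2 * (H : ℝ) ^ 2 + √(n * (n * H + (H : ℝ) ^ 2 * B)) := by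
  have hshift : ∀ h : ℕ, ‖∑ t ∈ Finset.Icc 1 n, v t - ∑ t ∈ Finset.Icc 1 n, v (t + h)‖ ≤ 2 * h := by
    intro h
    induction h with
    | zero => simp
    | succ h ih =>
      have h1 : ∀ m, ∑ t ∈ Finset.Icc 1 m, v (t + h) - ∑ t ∈ Finset.Icc 1 m, v (t + (h + 1)) =
          v (1 + h) - v (m + 1 + h) := by
        intro m
        induction m with
        | zero => simp
        | succ m ihm =>
          rw [Finset.sum_Icc_succ_top (by omega), Finset.sum_Icc_succ_top (by omega)]
          rw [show m + 1 + (h + 1) = m + 1 + 1 + h by ring]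
          linear_combination ihm
      have h2 : ‖v (1 + h) - v (n + 1 + h)‖ ≤ 2 := by
        refine (norm_sub_le _ _).trans ?_
        rw [hv, hv]; norm_num
      rw [← h1] at h2
      have := norm_add_le_of_le ih h2
      rw [sub_add_sub_cancel] at this
      push_cast; linarith
  -- Cauchy–Schwarz in `t`, then expansion of the square: diagonal pairs contribute `n` each, the
  -- others at most `B`.
  have hsq : ‖∑ t ∈ Finset.Icc 1 n, ∑ h ∈ Finset.range H, v (t + h)‖ ^ 2 ≤
      n * (n * H + (H : ℝ) ^ 2 * B) := by
    have h1 : ‖∑ t ∈ Finset.Icc 1 n, ∑ h ∈ Finset.range H, v (t + h)‖ ^ 2 ≤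
        n * ∑ t ∈ Finset.Icc 1 n, ‖∑ h ∈ Finset.range H, v (t + h)‖ ^ 2 := by
      calc _ ≤ (∑ t ∈ Finset.Icc 1 n, ‖∑ h ∈ Finset.range H, v (t + h)‖) ^ 2 := by
            gcongr; exact norm_sum_le _ _
        _ ≤ _ := by simpa using sq_sum_le_card_mul_sum_sq (s := Finset.Icc 1 n)
                      (f := fun t => ‖∑ h ∈ Finset.range H, v (t + h)‖)
    refine h1.trans ?_
    gcongr
    have h2 : ((∑ t ∈ Finset.Icc 1 n, ‖∑ h ∈ Finset.range H, v (t + h)‖ ^ 2 : ℝ) : ℂ) =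
        ∑ h ∈ Finset.range H, ∑ h' ∈ Finset.range H, ∑ t ∈ Finset.Icc 1 n,
          v (t + h) * (starRingEnd ℂ) (v (t + h')) := by
      push_cast
      simp_rw [← Complex.mul_conj', map_sum, Finset.sum_mul_sum]
      rw [Finset.sum_comm]
      exact Finset.sum_congr rfl fun h _ => Finset.sum_comm
    have h3 : ∑ t ∈ Finset.Icc 1 n, ‖∑ h ∈ Finset.range H, v (t + h)‖ ^ 2 =
        ‖((∑ t ∈ Finset.Icc 1 n, ‖∑ h ∈ Finset.range H, v (t + h)‖ ^ 2 : ℝ) : ℂ)‖ := by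
      rw [Complex.norm_real, Real.norm_eq_abs, abs_of_nonneg (by positivity)]
    rw [h3, h2]
    calc _ ≤ ∑ h ∈ Finset.range H, ∑ h' ∈ Finset.range H,
          ((if h = h' then (n : ℝ) else 0) + B) := by
          refine (norm_sum_le _ _).trans (Finset.sum_le_sum fun h hh => ?_)
          refine (norm_sum_le _ _).trans (Finset.sum_le_sum fun h' hh' => ?_)
          by_cases hhh : h = h'
          · subst hhh
            simp only [if_true]
            refine le_trans (norm_sum_le _ _) ?_
            simp [hv, hB0]
          · simp only [hhh, if_false, zero_add]
            exact hB h hh h' hh' hhh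
      _ ≤ _ := by
          simp only [Finset.sum_add_distrib, Finset.sum_ite_eq, Finset.sum_const, Finset.card_range,
            nsmul_eq_mul]
          rw [Finset.sum_congr rfl (fun x hx => if_pos hx)]
          simp
          exact le_of_eq (by ring)
  have h0 : (H : ℂ) * ∑ t ∈ Finset.Icc 1 n, v t =
      ∑ h ∈ Finset.range H, (∑ t ∈ Finset.Icc 1 n, v t - ∑ t ∈ Finset.Icc 1 n, v (t + h)) +
      ∑ t ∈ Finset.Icc 1 n, ∑ h ∈ Finset.range H, v (t + h) := by
    rw [Finset.sum_sub_distrib, Finset.sum_comm (s := Finset.Icc 1 n)]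
    simp
  have h1 : (H : ℝ) * ‖∑ t ∈ Finset.Icc 1 n, v t‖ = ‖(H : ℂ) * ∑ t ∈ Finset.Icc 1 n, v t‖ := by
    simp
  rw [h1, h0]
  refine (norm_add_le _ _).trans (add_le_add ?_ (Real.le_sqrt_of_sq_le hsq))
  refine (norm_sum_le _ _).trans ?_
  calc _ ≤ ∑ h ∈ Finset.range H, 2 * (H : ℝ) := by
        refine Finset.sum_le_sum fun h hh => (hshift h).trans ?_
        have : (h : ℝ) ≤ H := by exact_mod_cast (Finset.mem_range.1 hh).le
        linarith
    _ = _ := by simp; ring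

/-- Differencing a quadratic phase leaves a geometric progression of ratio `exp(2iγ(h - h'))`. The
linear frequency `α` enters only through a constant factor, whence the uniformity in `α`. -/
lemma norm_sum_chirp_correlation_le (γ α : ℝ) (n h h' : ℕ)
    (hne : Complex.exp (Complex.I * ((2 * γ * ((h : ℝ) - h') : ℝ) : ℂ)) ≠ 1) :
    ‖∑ t ∈ Finset.Icc 1 n, unitPhase 2 γ (t + h) * unitPhase 1 α (t + h) *
      (starRingEnd ℂ) (unitPhase 2 γ (t + h') * unitPhase 1 α (t + h'))‖ ≤
      2 / ‖Complex.exp (Complex.I * ((2 * γ * ((h : ℝ) - h') : ℝ) : ℂ)) - 1‖ := by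
  set z := Complex.exp (Complex.I * ((2 * γ * ((h : ℝ) - h') : ℝ) : ℂ)) with hz
  have : ∀ t, unitPhase 2 γ (t + h) * unitPhase 1 α (t + h) *
      (starRingEnd ℂ) (unitPhase 2 γ (t + h') * unitPhase 1 α (t + h')) =
      Complex.exp (Complex.I * ((γ * ((h : ℝ) ^ 2 - h' ^ 2) + α * (h - h') : ℝ) : ℂ)) * z ^ t := by
    intro t
    rw [map_mul, conj_unitPhase, conj_unitPhase, hz, ← Complex.exp_nat_mul]
    simp only [unitPhase, ← Complex.exp_add]
    congr 1; push_cast; ring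
  simp_rw [this]
  rw [← Finset.mul_sum, norm_mul, Complex.norm_exp_I_mul_ofReal, one_mul]
  exact norm_sum_pow_le (Complex.norm_exp_I_mul_ofReal _) hne n

lemma exp_ne_one_of_irrational {γ : ℝ} (hγ : Irrational (γ / Real.pi)) {d : ℤ} (hd : d ≠ 0) :
    Complex.exp (Complex.I * ((2 * γ * d : ℝ) : ℂ)) ≠ 1 := by
  intro h
  rw [Complex.exp_eq_one_iff] at h
  obtain ⟨m, hm⟩ := h
  have h1 : 2 * γ * d = m * (2 * Real.pi) := by
    have h2 : Complex.I * ((2 * γ * d : ℝ) : ℂ) = Complex.I * ((m * (2 * Real.pi) : ℝ) : ℂ) := by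
      rw [hm]; push_cast; ring
    exact_mod_cast mul_left_cancel₀ Complex.I_ne_zero h2
  have hd' : (d : ℝ) ≠ 0 := by exact_mod_cast hd
  refine hγ ⟨m / d, ?_⟩
  have := Real.pi_ne_zero
  push_cast
  field_simp
  linarith

/-- Weyl's estimate, locally uniform in the chirp rate and uniform in the frequency. -/
lemma eventually_forall_norm_sum_chirp_le {γ : ℝ} (hγ : Irrational (γ / Real.pi)) {ε : ℝ}
    (hε : 0 < ε) : ∀ᶠ p : ℕ × ℝ in atTop ×ˢ 𝓝 γ, ∀ α,
      ‖∑ t ∈ Finset.Icc 1 p.1, unitPhase 2 p.2 t * unitPhase 1 α t‖ ≤ ε * p.1 := by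
  obtain ⟨H, hH0, hH⟩ : ∃ H : ℕ, 0 < H ∧ 3 ≤ ε * √(H : ℝ) := by
    obtain ⟨H, hH⟩ := exists_nat_ge ((3 / ε) ^ 2)
    have hp : (0 : ℝ) < (3 / ε) ^ 2 := by positivity
    refine ⟨H, by exact_mod_cast hp.trans_le hH, ?_⟩
    have := Real.le_sqrt_of_sq_le hH
    rw [div_le_iff₀ hε] at this
    linarith
  set f : ℕ → ℕ → ℝ → ℝ := fun h h' x =>
    2 / ‖Complex.exp (Complex.I * ((2 * x * ((h : ℝ) - h') : ℝ) : ℂ)) - 1‖ with hf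
  have hf0 : ∀ h h' x, 0 ≤ f h h' x := fun h h' x => by positivity
  -- A sum is used as a crude maximum over the finitely many pairs; the added `1` leaves room for
  -- moving `x` near `γ`.
  set B : ℝ := ∑ h ∈ Finset.range H, ∑ h' ∈ Finset.range H, (f h h' γ + 1) with hBdef
  have hB0 : 0 ≤ B := Finset.sum_nonneg fun h _ => Finset.sum_nonneg fun h' _ => by
    linarith [hf0 h h' γ]
  have hloc : ∀ᶠ x : ℝ in 𝓝 γ, ∀ h ∈ Finset.range H, ∀ h' ∈ Finset.range H, h ≠ h' →
      Complex.exp (Complex.I * ((2 * x * ((h : ℝ) - h') : ℝ) : ℂ)) ≠ 1 ∧ f h h' x ≤ B := by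
    rw [Filter.eventually_all_finset]
    intro h hh
    rw [Filter.eventually_all_finset]
    intro h' hh'
    by_cases hne : h = h'
    · simp [hne]
    have h0 : Complex.exp (Complex.I * ((2 * γ * ((h : ℝ) - h') : ℝ) : ℂ)) ≠ 1 := by
      have := exp_ne_one_of_irrational hγ (d := (h : ℤ) - h') (by omega)
      simpa using this
    have hc : Continuous fun x : ℝ =>
        Complex.exp (Complex.I * ((2 * x * ((h : ℝ) - h') : ℝ) : ℂ)) := by fun_prop
    have h1 := hc.continuousAt.eventually_ne h0
    have h2 : Tendsto (f h h') (𝓝 γ) (𝓝 (f h h' γ)) :=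
      tendsto_const_nhds.div ((hc.sub continuous_const).norm.tendsto γ)
        (norm_ne_zero_iff.2 (sub_ne_zero.2 h0))
    have h3 := h2.eventually_le_const (lt_add_one (f h h' γ))
    have h4 : f h h' γ + 1 ≤ B := by
      have a1 : f h h' γ + 1 ≤ ∑ h' ∈ Finset.range H, (f h h' γ + 1) :=
        Finset.single_le_sum (f := fun h' => f h h' γ + 1)
          (fun i _ => by linarith [hf0 h i γ]) hh'
      exact a1.trans (Finset.single_le_sum (f := fun h => ∑ h' ∈ Finset.range H, (f h h' γ + 1))
          (fun i _ => Finset.sum_nonneg fun j _ => by linarith [hf0 i j γ]) hh)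
    filter_upwards [h1, h3] with x hx1 hx2 _
    exact ⟨hx1, hx2.trans h4⟩
  have hn : ∀ᶠ n : ℕ in atTop, H * B ≤ n ∧ 2 * (H : ℝ) ^ 2 ≤ n :=
    (tendsto_natCast_atTop_atTop.eventually_ge_atTop _).and
      (tendsto_natCast_atTop_atTop.eventually_ge_atTop _)
  filter_upwards [hn.prod_mk hloc] with p hp α
  obtain ⟨⟨hn1, hn2⟩, hx⟩ := hp
  have hv := van_der_corput (v := fun t => unitPhase 2 p.2 t * unitPhase 1 α t) (n := p.1) (H := H)
    (by simp) hB0 (fun h hh h' hh' hne =>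
      (norm_sum_chirp_correlation_le p.2 α p.1 h h' (hx h hh h' hh' hne).1).trans
        (hx h hh h' hh' hne).2)
  have hH' : (1 : ℝ) ≤ H := by exact_mod_cast hH0
  have hs : 1 ≤ √(H : ℝ) := Real.one_le_sqrt.2 hH'
  have hss : √(H : ℝ) * √(H : ℝ) = H := Real.mul_self_sqrt (by linarith)
  set n : ℝ := (p.1 : ℝ)
  have hnn : 0 ≤ n := Nat.cast_nonneg _
  have h1 : √(n * (n * H + (H : ℝ) ^ 2 * B)) ≤ 2 * n * √H := by
    refine Real.sqrt_le_iff.2 ⟨by positivity, ?_⟩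
    rw [mul_pow, sq (√(H : ℝ)), hss]
    have : (H : ℝ) ^ 2 * B ≤ n * H := by nlinarith
    nlinarith
  set x := ‖∑ t ∈ Finset.Icc 1 p.1, unitPhase 2 p.2 t * unitPhase 1 α t‖
  have h2 : (H : ℝ) * x ≤ 3 * n * √H := by nlinarith
  have h3 : √(H : ℝ) * x ≤ 3 * n := by
    have : √(H : ℝ) * (√(H : ℝ) * x) ≤ √(H : ℝ) * (3 * n) := by
      rw [← mul_assoc, hss]; linarith
    exact le_of_mul_le_mul_left this (by linarith)
  have h4 : √(H : ℝ) * x ≤ √(H : ℝ) * (ε * n) := by nlinarith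
  exact le_of_mul_le_mul_left h4 (by linarith)

lemma phaseVanishes_two {γ : ℝ} (hγ : Irrational (γ / Real.pi)) : PhaseVanishes 2 γ := by
  refine Metric.tendsto_nhds.2 fun ε hε => ?_
  filter_upwards [eventually_forall_norm_sum_chirp_le hγ (half_pos hε)] with p hp
  have h := hp 0
  have h0 : ∀ t, unitPhase 1 0 t = 1 := by simp [unitPhase]
  simp only [h0, mul_one] at h
  rw [dist_zero_right, phaseMean, norm_div, Complex.norm_natCast]
  exact (div_le_of_le_mul₀ (by positivity) (by positivity) h).trans_lt (half_lt_self hε)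

lemma decorrelates_chirp {θ : ℝ × ℝ × ℝ} (hθ : Irrational (θ.2.2 / Real.pi)) (α : ℝ) :
    Decorrelates 1 (powHarmonic 2 θ) α := by
  have key : ∀ γ : ℝ, Irrational (γ / Real.pi) → Tendsto (fun p : ℕ × ℝ =>
      (∑ t ∈ Finset.Icc 1 p.1, unitPhase 2 γ t * unitPhase 1 p.2 t) / (p.1 : ℂ))
      (atTop ×ˢ 𝓝 α) (𝓝 0) := by
    intro γ hγ
    refine Metric.tendsto_nhds.2 fun ε hε => ?_
    have h1 := (eventually_forall_norm_sum_chirp_le hγ (half_pos hε)).curry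
    -- Here the chirp rate is fixed, so the neighbourhood is evaluated at its centre; uniformity in
    -- the linear frequency is what is used.
    have h2 : ∀ᶠ n : ℕ in atTop, ∀ a, ‖∑ t ∈ Finset.Icc 1 n, unitPhase 2 γ t * unitPhase 1 a t‖ ≤
        ε / 2 * n := h1.mono fun n hn => hn.self_of_nhds
    filter_upwards [tendsto_fst.eventually h2] with p hp
    rw [dist_zero_right, norm_div, Complex.norm_natCast]
    exact (div_le_of_le_mul₀ (by positivity) (by positivity) (hp p.2)).trans_lt (half_lt_self hε)
  have hneg : Irrational (-θ.2.2 / Real.pi) := by rw [neg_div]; exact hθ.neg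
  have := ((key _ hθ).const_mul (cAmp θ / 2)).add
    ((key _ hneg).const_mul ((starRingEnd ℂ) (cAmp θ) / 2))
  rw [mul_zero, mul_zero, add_zero] at this
  refine this.congr fun p => ?_
  simp only [← mul_div_assoc, ← add_div, Finset.mul_sum, ← Finset.sum_add_distrib]
  congr 1
  refine Finset.sum_congr rfl fun t _ => ?_
  rw [powHarmonic_eq_add]; ring

/-! ### From mean-square closeness to closeness of parameters. -/

lemma vec_powHarmonic_sub (k n : ℕ) (a b c d β : ℝ) :
    vec n (powHarmonic k (a - c, b - d, β)) =
      vec n (powHarmonic k (a, b, β)) - vec n (powHarmonic k (c, d, β)) := by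
  rw [← map_sub]
  congr 1
  funext t
  simp [powHarmonic]; ring

lemma norm_vec_powHarmonic_le (k n : ℕ) (θ : ℝ × ℝ × ℝ) :
    ‖vec n (powHarmonic k θ)‖ ≤ ‖cAmp θ‖ :=
  norm_vec_le (norm_nonneg _) fun t _ => abs_powHarmonic_le k θ t

lemma PhaseVanishes.tendsto_norm_vec_sq {k : ℕ} {θ : ℝ × ℝ × ℝ} (h : PhaseVanishes k (2 * θ.2.2))
    {F : Filter ℕ} (hF : F ≤ atTop) :
    Tendsto (fun n => ‖vec n (powHarmonic k θ)‖ ^ 2) F (𝓝 (sqAmplitude θ / 2)) := by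
  have h1 := (h.tendsto_of_le hF tendsto_const_nhds).const_mul (sqAmplitude θ / 2)
  rw [mul_zero] at h1
  rw [tendsto_iff_norm_sub_tendsto_zero]
  refine squeeze_zero' (Eventually.of_forall fun _ => norm_nonneg _) ?_ h1
  filter_upwards [hF (eventually_ge_atTop 1)] with n hn
  exact abs_norm_vec_powHarmonic_sq_sub_le k hn θ

lemma Decorrelates.tendsto_inner {k : ℕ} (hk : k = 1 ∨ k = 2) {w : ℕ → ℝ} {β : ℝ}
    (hw : Decorrelates k w β) {F : Filter ℕ} (hF : F ≤ atTop) {θ : ℕ → ℝ × ℝ × ℝ}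
    (hθ : Tendsto (fun n => (θ n).2.2) F (𝓝 β)) {b : ℝ}
    (hb : ∀ᶠ n in F, ‖vec n (powHarmonic k (θ n))‖ ≤ b) :
    Tendsto (fun n => inner ℝ (vec n w) (vec n (powHarmonic k (θ n)))) F (𝓝 0) := by
  refine Metric.tendsto_nhds.2 fun ε hε => ?_
  have hδ : 0 < ε / (|b| + 1) := by positivity
  filter_upwards [hb, hw.eventually_abs_inner_le hk hF hθ hδ] with n h1 h2
  rw [dist_zero_right, Real.norm_eq_abs]
  refine h2.trans_lt ?_
  have h3 : ‖vec n (powHarmonic k (θ n))‖ < |b| + 1 := by linarith [le_abs_self b]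
  calc _ < ε / (|b| + 1) * (|b| + 1) := by gcongr
    _ = ε := by field_simp

lemma abs_powHarmonic_sub_le (k : ℕ) (a b β β' : ℝ) (t : ℕ) :
    |powHarmonic k (a, b, β) t - powHarmonic k (a, b, β') t| ≤
      2 * ‖cAmp (a, b, β)‖ * ((t : ℝ) ^ k * |Real.sin ((β - β') / 2)|) := by
  have h1 : unitPhase k β t = unitPhase k β' t *
      Complex.exp (Complex.I * (((β - β') * (t : ℝ) ^ k : ℝ) : ℂ)) := by
    rw [unitPhase, unitPhase, ← Complex.exp_add]
    congr 1; push_cast; ring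
  have h2 : powHarmonic k (a, b, β) t - powHarmonic k (a, b, β') t =
      (cAmp (a, b, β) * (unitPhase k β' t *
        (Complex.exp (Complex.I * (((β - β') * (t : ℝ) ^ k : ℝ) : ℂ)) - 1))).re := by
    rw [powHarmonic_eq_re, powHarmonic_eq_re, ← Complex.sub_re]
    change (cAmp (a, b, β) * unitPhase k β t - cAmp (a, b, β) * unitPhase k β' t).re = _
    rw [h1]
    congr 1; ring
  rw [h2]
  refine (Complex.abs_re_le_norm _).trans ?_
  rw [norm_mul, norm_mul, norm_unitPhase, one_mul, Complex.norm_exp_I_mul_ofReal_sub_one,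
    Real.norm_eq_abs, abs_mul, abs_two]
  have h3 := abs_sin_nat_mul_le (t ^ k) ((β - β') / 2)
  push_cast at h3
  rw [show (t : ℝ) ^ k * ((β - β') / 2) = (β - β') * (t : ℝ) ^ k / 2 by ring] at h3
  have : 0 ≤ ‖cAmp (a, b, β)‖ := norm_nonneg _
  nlinarith

/-- A fitted component that approaches the true one in mean square has parameters approaching the
true parameters. -/
lemma tendsto_of_tendsto_norm_vec_sub {k : ℕ} (hk : k = 1 ∨ k = 2) {F : Filter ℕ} [F.NeBot]
    (hF : F ≤ atTop) {est : ℕ → ℝ × ℝ × ℝ} {θ : ℝ × ℝ × ℝ} {β : ℝ} (hβ : β ∈ Set.Icc 0 Real.pi)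
    (hest : Tendsto (fun n => (est n).2.2) F (𝓝 β)) (hθ : θ.2.2 ∈ Set.Ioo 0 Real.pi)
    (hpos : 0 < sqAmplitude θ) (h2θ : PhaseVanishes k (2 * θ.2.2))
    (hres : (PhaseVanishes k (β + θ.2.2) ∧ PhaseVanishes k (β - θ.2.2)) ∨
      (PhaseVanishes k (2 * β) ∧ (PhaseVanishes k (β + θ.2.2) ∨ PhaseVanishes k (β - θ.2.2))))
    (hD : Tendsto (fun n => ‖vec n (powHarmonic k (est n)) - vec n (powHarmonic k θ)‖) F (𝓝 0)) :
    Tendsto est F (𝓝 θ) := by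
  set D := fun n => vec n (powHarmonic k (est n)) - vec n (powHarmonic k θ) with hDdef
  have hGest : ∀ n, vec n (powHarmonic k (est n)) = vec n (powHarmonic k θ) + D n := by
    intro n; simp [hDdef]
  have hG0 := h2θ.tendsto_norm_vec_sq hF
  have hGD : Tendsto (fun n => inner ℝ (vec n (powHarmonic k θ)) (D n)) F (𝓝 0) := by
    refine squeeze_zero_norm (fun n => ?_) (by simpa using hD.const_mul ‖cAmp θ‖)
    refine (norm_inner_le_norm _ _).trans ?_
    gcongr
    exact norm_vec_powHarmonic_le k n θ
  have hin : Tendsto (fun n => inner ℝ (vec n (powHarmonic k θ)) (vec n (powHarmonic k (est n)))) F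
      (𝓝 (sqAmplitude θ / 2)) := by
    have := hG0.add hGD
    rw [add_zero] at this
    refine this.congr fun n => ?_
    rw [hGest, inner_add_right, real_inner_self_eq_norm_sq]
  have hest2 : Tendsto (fun n => ‖vec n (powHarmonic k (est n))‖ ^ 2) F (𝓝 (sqAmplitude θ / 2)) := by
    have := (hG0.add (hGD.const_mul 2)).add (hD.pow 2)
    rw [mul_zero, add_zero, zero_pow two_ne_zero, add_zero] at this
    refine this.congr fun n => ?_
    rw [hGest, norm_add_sq_real, add_sub_cancel_left]
  have hbd : ∀ᶠ n in F, ‖vec n (powHarmonic k (est n))‖ ≤ sqAmplitude θ / 2 + 1 := by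
    filter_upwards [hest2.eventually_le_const (lt_add_one _)] with n hn
    refine le_of_sq_le_sq (hn.trans ?_) (by positivity)
    nlinarith
  -- If both means vanished, the inner product of the fit with the true component would tend to `0`
  -- instead of half the squared amplitude.
  have hnot : ¬ (PhaseVanishes k (β + θ.2.2) ∧ PhaseVanishes k (β - θ.2.2)) := by
    rintro ⟨h1, h2⟩
    have := (decorrelates_powHarmonic h1 h2).tendsto_inner hk hF hest hbd
    linarith [tendsto_nhds_unique hin this]
  obtain ⟨h2β, hone⟩ := hres.resolve_left hnot
  -- the fitted amplitude converges
  have hs := h2β.tendsto_of_le hF (hest.const_mul 2)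
  have hamp_bd : ∀ᶠ n in F, sqAmplitude (est n) ≤ 2 * sqAmplitude θ + 4 := by
    filter_upwards [hs.eventually_le_const (by norm_num : (0 : ℝ) < 1 / 2),
      hest2.eventually_le_const (lt_add_one _), hF (eventually_ge_atTop 1)] with n h1 h2 h3
    have h4 := (abs_le.1 (abs_norm_vec_powHarmonic_sq_sub_le k h3 (est n))).1
    have h5 : 0 ≤ sqAmplitude (est n) := by unfold sqAmplitude; positivity
    nlinarith
  have hamp : Tendsto (fun n => sqAmplitude (est n)) F (𝓝 (sqAmplitude θ)) := by
    have h1 : Tendsto (fun n => sqAmplitude (est n) / 2 - ‖vec n (powHarmonic k (est n))‖ ^ 2) F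
        (𝓝 0) := by
      refine squeeze_zero_norm' ?_ (by simpa using hs.const_mul (sqAmplitude θ + 2))
      filter_upwards [hamp_bd, hF (eventually_ge_atTop 1)] with n h1 h2
      rw [norm_sub_rev]
      refine (abs_norm_vec_powHarmonic_sq_sub_le k h2 (est n)).trans ?_
      gcongr
      linarith
    have := (h1.add hest2).const_mul 2
    simp only [sub_add_cancel] at this
    convert this using 2 <;> ring
  have hR : Tendsto (fun n => ‖cAmp (est n)‖) F (𝓝 ‖cAmp θ‖) := by
    have := hamp.sqrt
    simpa only [← norm_cAmp_sq, Real.sqrt_sq (norm_nonneg _)] using this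
  have hRpos : 0 < ‖cAmp θ‖ := by
    have h1 := norm_cAmp_sq θ
    have h2 := norm_nonneg (cAmp θ)
    nlinarith
  -- the phase mean that does not vanish has modulus tending to one
  have hto : ∀ a c : ℕ → ℝ, Tendsto a F (𝓝 0) → (∀ n, c n ≤ 1) →
      (∀ n, |inner ℝ (vec n (powHarmonic k (est n))) (vec n (powHarmonic k θ))| ≤
        ‖cAmp (est n)‖ * ‖cAmp θ‖ / 2 * (a n + c n)) → Tendsto c F (𝓝 1) := by
    intro a c ha hc hle
    have hq : Tendsto (fun n => ‖cAmp (est n)‖ * ‖cAmp θ‖ / 2) F (𝓝 (‖cAmp θ‖ * ‖cAmp θ‖ / 2)) :=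
      (hR.mul_const _).div_const _
    have hl := (hin.div hq (by positivity)).sub ha
    rw [← sq, norm_cAmp_sq, div_self (by positivity), sub_zero] at hl
    refine tendsto_of_tendsto_of_tendsto_of_le_of_le' hl tendsto_const_nhds ?_
      (Eventually.of_forall hc)
    filter_upwards [hR.eventually_const_lt hRpos] with n hn
    have h1 := (le_abs_self _).trans (hle n)
    rw [real_inner_comm] at h1
    simp only [Pi.div_apply]
    have hq0 : 0 < ‖cAmp (est n)‖ * ‖cAmp θ‖ / 2 := by positivity
    have := (div_le_iff₀' hq0).2 h1
    linarith
  -- Once the bound on the minimum drops below `1`, the minimum must be its second entry, which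
  -- gives the rate `o(n ^ (-k))` needed to replace the frequency.
  have hsin : ∀ γ : ℕ → ℝ, Tendsto (fun n => ‖phaseMean k n (γ n)‖) F (𝓝 1) →
      Tendsto (fun n : ℕ => (n : ℝ) ^ k * |Real.sin (γ n / 2)|) F (𝓝 0) := by
    intro γ hγ
    have h1 : Tendsto (fun n => 10000 * √(2 * (1 - ‖phaseMean k n (γ n)‖))) F (𝓝 0) := by
      have := (((hγ.const_sub 1).const_mul 2).sqrt).const_mul 10000
      simpa using this
    refine squeeze_zero' (Eventually.of_forall fun _ => by positivity) ?_ h1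
    filter_upwards [h1.eventually_lt_const one_pos, hF (eventually_ge_atTop 4)] with n h2 h3
    have h4 := min_one_le_sqrt_one_sub_norm_phaseMean hk h3 (γ n)
    rcases min_le_iff.1 h4 with h5 | h5
    · linarith
    · exact h5
  have hsin' : ∀ (γ : ℕ → ℝ) (g : ℝ), Tendsto (fun n => ‖phaseMean k n (γ n)‖) F (𝓝 1) →
      Tendsto γ F (𝓝 g) → Real.sin (g / 2) = 0 := by
    intro γ g h1 h2
    have h3 : Tendsto (fun n => |Real.sin (γ n / 2)|) F (𝓝 |Real.sin (g / 2)|) :=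
      ((Real.continuous_sin.tendsto _).comp (h2.div_const 2)).abs
    have h4 : Tendsto (fun n => |Real.sin (γ n / 2)|) F (𝓝 0) := by
      refine squeeze_zero' (Eventually.of_forall fun _ => abs_nonneg _) ?_ (hsin γ h1)
      filter_upwards [hF (eventually_ge_atTop 1)] with n hn
      have : (1 : ℝ) ≤ (n : ℝ) ^ k := one_le_pow₀ (by exact_mod_cast hn)
      exact le_mul_of_one_le_left (abs_nonneg _) this
    exact abs_eq_zero.1 (tendsto_nhds_unique h3 h4)
  -- The surviving mean must be the one at the difference: at the sum it would force `sin ((β +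
  -- θ.2.2) / 2) = 0`, but that half-sum lies strictly between `0` and `π`.
  have hminus : Tendsto (fun n => ‖phaseMean k n ((est n).2.2 - θ.2.2)‖) F (𝓝 1) := by
    rcases hone with h | h
    · refine hto _ _ (h.tendsto_of_le hF (hest.add_const _)) (fun n => norm_phaseMean_le_one _ _ _)
        fun n => abs_inner_vec_powHarmonic_le k n _ _
    · exfalso
      have h1 : Tendsto (fun n => ‖phaseMean k n ((est n).2.2 + θ.2.2)‖) F (𝓝 1) := by
        refine hto _ _ (h.tendsto_of_le hF (hest.sub_const _))
          (fun n => norm_phaseMean_le_one _ _ _) fun n => ?_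
        rw [add_comm]
        exact (abs_inner_vec_powHarmonic_le k n _ _).trans_eq (by ring)
      have h2 := hsin' _ _ h1 (hest.add_const _)
      have h3 : 0 < Real.sin ((β + θ.2.2) / 2) :=
        Real.sin_pos_of_pos_of_lt_pi (by linarith [hβ.1, hθ.1]) (by linarith [hβ.2, hθ.2])
      linarith
  have hββ : β = θ.2.2 := by
    have h2 := hsin' _ _ hminus (hest.sub_const _)
    have h3 := (Real.sin_eq_zero_iff_of_lt_of_lt (by linarith [hβ.1, hθ.2, hθ.1, hβ.2])
      (by linarith [hβ.2, hθ.1, hβ.1, hθ.2])).1 h2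
    linarith
  have hsm := hsin _ hminus
  -- replace the fitted frequency by the true one
  have hclose : Tendsto (fun n => ‖vec n (powHarmonic k (est n)) -
      vec n (powHarmonic k ((est n).1, (est n).2.1, θ.2.2))‖) F (𝓝 0) := by
    have h1 := (hR.const_mul 2).mul hsm
    rw [mul_zero] at h1
    refine squeeze_zero (fun _ => norm_nonneg _) (fun n => ?_) h1
    rw [← map_sub]
    refine norm_vec_le (by positivity) fun t ht => ?_
    refine (abs_powHarmonic_sub_le k (est n).1 (est n).2.1 (est n).2.2 θ.2.2 t).trans ?_
    have : (t : ℝ) ≤ n := by exact_mod_cast (Finset.mem_Icc.1 ht).2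
    gcongr
  have hdiff : Tendsto (fun n => ‖vec n (powHarmonic k
      ((est n).1 - θ.1, (est n).2.1 - θ.2.1, θ.2.2))‖) F (𝓝 0) := by
    refine squeeze_zero (fun _ => norm_nonneg _) (fun n => ?_) (by simpa using hclose.add hD)
    rw [vec_powHarmonic_sub]
    rw [← norm_sub_rev (vec n (powHarmonic k ((est n).1, (est n).2.1, θ.2.2)))]
    exact (norm_add_le _ _).trans_eq' (by simp)
  -- At the fixed frequency `θ.2.2` the mean square eventually dominates a quarter of the squared
  -- amplitude, so convergence of the difference vector controls both coefficients.
  have hsq : Tendsto (fun n => ((est n).1 - θ.1) ^ 2 + ((est n).2.1 - θ.2.1) ^ 2) F (𝓝 0) := by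
    refine squeeze_zero' (Eventually.of_forall fun _ => by positivity) ?_
      (by simpa using (hdiff.pow 2).const_mul 4)
    have h1 := h2θ.tendsto_of_le hF tendsto_const_nhds
    filter_upwards [h1.eventually_le_const (by norm_num : (0 : ℝ) < 1 / 2),
      hF (eventually_ge_atTop 1)] with n h2 h3
    have h4 := (abs_le.1 (abs_norm_vec_powHarmonic_sq_sub_le k h3
      ((est n).1 - θ.1, (est n).2.1 - θ.2.1, θ.2.2))).1
    simp only [sqAmplitude] at h4
    have h5 : 0 ≤ ((est n).1 - θ.1) ^ 2 + ((est n).2.1 - θ.2.1) ^ 2 := by positivity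
    nlinarith
  have hco : ∀ f : ℕ → ℝ, ∀ c : ℝ, (∀ n, (f n - c) ^ 2 ≤
      ((est n).1 - θ.1) ^ 2 + ((est n).2.1 - θ.2.1) ^ 2) → Tendsto f F (𝓝 c) := by
    intro f c hf
    rw [tendsto_iff_norm_sub_tendsto_zero]
    have h1 := (squeeze_zero (fun n => sq_nonneg _) hf hsq).sqrt
    simpa [Real.sqrt_sq_eq_abs] using h1
  have hA : Tendsto (fun n => (est n).1) F (𝓝 θ.1) := hco _ _ fun n => by nlinarith
  have hB : Tendsto (fun n => (est n).2.1) F (𝓝 θ.2.1) := hco _ _ fun n => by nlinarith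
  exact hA.prodMk_nhds (hB.prodMk_nhds (hββ ▸ hest))

lemma errorSumSq_eq (k : ℕ) {n : ℕ} (hn : 1 ≤ n) (y : ℕ → ℝ) (θ : ℝ × ℝ × ℝ) :
    errorSumSq (powHarmonic k) n y θ = n * ‖vec n y - vec n (powHarmonic k θ)‖ ^ 2 := by
  have hn' : (n : ℝ) ≠ 0 := by exact_mod_cast (by omega : n ≠ 0)
  rw [← map_sub, norm_vec_sq, mul_div_cancel₀ _ hn', errorSumSq]
  rfl

/-! ### Separated frequencies and a single least squares step. -/

/-- The pair of frequencies `β` and `β'` is asymptotically orthogonal. -/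
def NonResonant (k : ℕ) (β β' : ℝ) : Prop :=
  PhaseVanishes k (β + β') ∧ PhaseVanishes k (β - β')

/-- The frequencies `β i` are such that no candidate frequency resonates with two of them. -/
structure SeparatedFrequencies {ι : Type*} (k : ℕ) (β : ι → ℝ) : Prop where
  mem_Ioo : ∀ i, β i ∈ Set.Ioo 0 Real.pi
  nonResonant : ∀ b ∈ Set.Icc 0 Real.pi, ∀ i j, i ≠ j →
    NonResonant k b (β i) ∨ NonResonant k b (β j)
  resonant : ∀ b ∈ Set.Icc 0 Real.pi, ∀ i, NonResonant k b (β i) ∨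
    (PhaseVanishes k (2 * b) ∧ (PhaseVanishes k (b + β i) ∨ PhaseVanishes k (b - β i)))

namespace SeparatedFrequencies

variable {ι : Type*} {k : ℕ} {β : ι → ℝ}

lemma mem_Icc (h : SeparatedFrequencies k β) (i : ι) : β i ∈ Set.Icc 0 Real.pi :=
  ⟨(h.mem_Ioo i).1.le, (h.mem_Ioo i).2.le⟩

lemma not_nonResonant_self (i : ι) : ¬ NonResonant k (β i) (β i) := fun h =>
  not_phaseVanishes_zero k (by simpa using h.2)

lemma phaseVanishes_two_mul (h : SeparatedFrequencies k β) (i : ι) : PhaseVanishes k (2 * β i) :=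
  ((h.resonant _ (h.mem_Icc i) i).resolve_left (not_nonResonant_self i)).1

lemma nonResonant_of_ne (h : SeparatedFrequencies k β) {i j : ι} (hij : i ≠ j) :
    NonResonant k (β i) (β j) :=
  (h.nonResonant _ (h.mem_Icc i) i j hij).resolve_left (not_nonResonant_self i)

end SeparatedFrequencies

lemma le_of_sq_le_mul_add {x p q : ℝ} (hp : 0 ≤ p) (hq : 0 ≤ q) (h : x ^ 2 ≤ p * x + q) :
    x ≤ p + q + 1 := by
  by_contra! hx
  nlinarith

/-- One step of the sequential fit: the least squares component converges to the component with
the largest amplitude, in mean square and in its parameters. -/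
theorem leastSquares_consistent {ι : Type*} {k : ℕ} (hk : k = 1 ∨ k = 2) {K : Set ℝ}
    {θ : ι → ℝ × ℝ × ℝ} (hsep : SeparatedFrequencies k fun i => (θ i).2.2) {J : Finset ι} {i₀ : ι}
    (hi₀ : i₀ ∈ J) (hamp : ∀ i ∈ J, i ≠ i₀ → sqAmplitude (θ i) < sqAmplitude (θ i₀))
    (hpos : 0 < sqAmplitude (θ i₀)) (hK : θ i₀ ∈ paramSpace K) {w : ℕ → ℝ}
    (hw : ∀ b ∈ Set.Icc 0 Real.pi, Decorrelates k w b) {r : ℕ → ℕ → ℝ}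
    (hr : Tendsto (fun n => ‖vec n (r n)‖) atTop (𝓝 0)) {est : ℕ → ℝ × ℝ × ℝ}
    (hest : ∀ᶠ n in atTop, IsLeastSquares (powHarmonic k) K n
      (fun t => ∑ i ∈ J, powHarmonic k (θ i) t + w t + r n t) (est n)) :
    Tendsto (fun n => ‖vec n (powHarmonic k (est n)) - vec n (powHarmonic k (θ i₀))‖) atTop (𝓝 0) ∧
      Tendsto est atTop (𝓝 (θ i₀)) := by
  classical
  set Z : ℕ → ℝ := fun t => ∑ i ∈ J.erase i₀, powHarmonic k (θ i) t with hZ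
  have hZsum : ∀ n, vec n Z = ∑ i ∈ J.erase i₀, vec n (powHarmonic k (θ i)) := by
    intro n
    rw [← map_sum]
    congr 1
    funext t
    simp [hZ]
  set G0 : ∀ n, EuclideanSpace ℝ (Finset.Icc 1 n) := fun n => vec n (powHarmonic k (θ i₀)) with hG0
  set G : ∀ n, EuclideanSpace ℝ (Finset.Icc 1 n) := fun n => vec n (powHarmonic k (est n)) with hG
  set c₀ := ‖cAmp (θ i₀)‖ with hc₀
  have hG0le : ∀ n, ‖G0 n‖ ≤ c₀ := fun n => norm_vec_powHarmonic_le k n _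
  -- Minimality against the true leading component reads `‖E - D‖² ≤ ‖E‖²` with `E = Z + w + r` and
  -- `D = G - G0`; expanding the square gives the inequality.
  have hineq : ∀ᶠ n in atTop, ‖G n - G0 n‖ ^ 2 ≤ 2 * inner ℝ (vec n Z) (G n - G0 n) +
      2 * inner ℝ (vec n w) (G n - G0 n) + 2 * inner ℝ (vec n (r n)) (G n - G0 n) := by
    filter_upwards [hest, eventually_ge_atTop 1] with n h hn
    have h1 := h.2 _ hK
    rw [errorSumSq_eq k hn, errorSumSq_eq k hn] at h1
    have hn' : (0 : ℝ) < n := by exact_mod_cast hn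
    have h2 := le_of_mul_le_mul_left h1 hn'
    have hy : vec n (fun t => ∑ i ∈ J, powHarmonic k (θ i) t + w t + r n t) =
        G0 n + (vec n Z + vec n w + vec n (r n)) := by
      simp only [hG0, ← map_add]
      congr 1
      funext t
      simp only [Pi.add_apply, hZ]
      rw [← Finset.add_sum_erase _ _ hi₀]
      ring
    rw [hy] at h2
    have e1 : G0 n + (vec n Z + vec n w + vec n (r n)) - vec n (powHarmonic k (est n)) =
        (vec n Z + vec n w + vec n (r n)) - (G n - G0 n) := by simp only [hG]; abel
    have e2 : G0 n + (vec n Z + vec n w + vec n (r n)) - vec n (powHarmonic k (θ i₀)) =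
        vec n Z + vec n w + vec n (r n) := by simp only [hG0]; abel
    rw [e1, e2, norm_sub_sq_real, inner_add_left, inner_add_left] at h2
    linarith
  -- the correlations with the true leading component vanish
  have hconst : ∀ {v : ℕ → ℝ}, Decorrelates k v (θ i₀).2.2 →
      Tendsto (fun n => inner ℝ (vec n v) (G0 n)) atTop (𝓝 0) := fun hv =>
    hv.tendsto_inner hk le_rfl tendsto_const_nhds (Eventually.of_forall hG0le)
  have hwG0 : Tendsto (fun n => inner ℝ (vec n w) (G0 n)) atTop (𝓝 0) :=
    hconst (hw _ (hsep.mem_Icc i₀))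
  have hZG0 : Tendsto (fun n => inner ℝ (vec n Z) (G0 n)) atTop (𝓝 0) := by
    refine hconst (Decorrelates.sum _ fun i hi => ?_)
    have := hsep.nonResonant_of_ne (Finset.ne_of_mem_erase hi).symm
    exact decorrelates_powHarmonic this.1 this.2
  -- Ultrafilters replace subsequences: the fitted frequency lies in a compact interval and so
  -- converges along each of them.
  suffices hmain : ∀ F : Ultrafilter ℕ, (F : Filter ℕ) ≤ atTop →
      Tendsto (fun n => ‖G n - G0 n‖) F (𝓝 0) ∧ Tendsto est F (𝓝 (θ i₀)) from
    ⟨(tendsto_iff_ultrafilter _ _ _).2 fun F hF => (hmain F hF).1,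
      (tendsto_iff_ultrafilter _ _ _).2 fun F hF => (hmain F hF).2⟩
  intro F hF
  obtain ⟨b, hb, hFb⟩ : ∃ b ∈ Set.Icc 0 Real.pi, Tendsto (fun n => (est n).2.2) F (𝓝 b) := by
    have h1 : ∀ᶠ n in F, (est n).2.2 ∈ Set.Icc 0 Real.pi := by
      filter_upwards [hF hest] with n hn
      exact hn.1.2.2
    obtain ⟨b, hb, h⟩ := isCompact_Icc.ultrafilter_le_nhds (F.map fun n => (est n).2.2)
      (le_principal_iff.2 h1)
    exact ⟨b, hb, h⟩
  -- boundedness of the fitted component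
  set cZ := ∑ i ∈ J.erase i₀, ‖cAmp (θ i)‖ with hcZ
  have hZle : ∀ n, ‖vec n Z‖ ≤ cZ := fun n => by
    rw [hZsum]
    exact (norm_sum_le _ _).trans (Finset.sum_le_sum fun i _ => norm_vec_powHarmonic_le k n _)
  have hcZ0 : 0 ≤ cZ := Finset.sum_nonneg fun _ _ => norm_nonneg _
  have hc₀0 : 0 ≤ c₀ := norm_nonneg _
  -- The relative bound on the noise correlation is linear in `‖G‖`, so the basic inequality is
  -- quadratic on the left and linear on the right. This bounds the fit even for unbounded `K`.
  obtain ⟨bd, hDbd⟩ : ∃ bd, ∀ᶠ n in F, ‖G n - G0 n‖ ≤ bd := by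
    refine ⟨(2 * cZ + 2 + 2) + (2 * c₀ + 2) + 1, ?_⟩
    have hw1 := (hw b hb).eventually_abs_inner_le hk hF hFb one_pos
    have hw2 : ∀ᶠ n in F, |inner ℝ (vec n w) (G0 n)| ≤ 1 := by
      have := (hwG0.abs).mono_left hF
      rw [abs_zero] at this
      exact this.eventually_le_const one_pos
    filter_upwards [hF hineq, hw1, hw2, hF (hr.eventually_le_const one_pos)] with n h1 h2 h3 h4
    change |inner ℝ (vec n w) (G n)| ≤ 1 * ‖G n‖ at h2
    refine le_of_sq_le_mul_add (by positivity) (by positivity) (h1.trans ?_)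
    have hGn : ‖G n‖ ≤ ‖G n - G0 n‖ + c₀ := by
      have := norm_le_norm_sub_add (G n) (G0 n)
      linarith [hG0le n]
    have a1 := (real_inner_le_norm (vec n Z) (G n - G0 n)).trans
      (mul_le_mul_of_nonneg_right (hZle n) (norm_nonneg _))
    have a2 := (real_inner_le_norm (vec n (r n)) (G n - G0 n)).trans
      (mul_le_mul_of_nonneg_right h4 (norm_nonneg _))
    have a3 : inner ℝ (vec n w) (G n - G0 n) ≤ ‖G n - G0 n‖ + c₀ + 1 := by
      rw [inner_sub_right]
      linarith [(abs_le.1 h2).2, (abs_le.1 h3).1]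
    linarith
  have hGbd : ∀ᶠ n in F, ‖vec n (powHarmonic k (est n))‖ ≤ bd + c₀ := by
    filter_upwards [hDbd] with n hn
    have := norm_le_norm_sub_add (G n) (G0 n)
    linarith [hG0le n]
  have hwG : Tendsto (fun n => inner ℝ (vec n w) (G n)) F (𝓝 0) :=
    (hw b hb).tendsto_inner hk hF hFb hGbd
  have hrD : Tendsto (fun n => inner ℝ (vec n (r n)) (G n - G0 n)) F (𝓝 0) := by
    have := (hr.mono_left hF).mul_const bd
    rw [zero_mul] at this
    refine squeeze_zero_norm' ?_ this
    filter_upwards [hDbd] with n hn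
    exact (norm_inner_le_norm _ _).trans (by gcongr)
  set err : ℕ → ℝ := fun n => -(2 * inner ℝ (vec n Z) (G0 n)) +
    2 * (inner ℝ (vec n w) (G n) - inner ℝ (vec n w) (G0 n)) +
    2 * inner ℝ (vec n (r n)) (G n - G0 n) with herr
  have herr0 : Tendsto err F (𝓝 0) := by
    simpa using ((((hZG0.mono_left hF).const_mul 2).neg).add
      ((hwG.sub (hwG0.mono_left hF)).const_mul 2)).add (hrD.const_mul 2)
  have hineq2 : ∀ᶠ n in F, ‖G n - G0 n‖ ^ 2 ≤
      2 * (∑ i ∈ J.erase i₀, inner ℝ (vec n (powHarmonic k (θ i))) (G n)) + err n := by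
    filter_upwards [hF hineq] with n hn
    rw [← sum_inner, ← hZsum]
    simp only [herr]
    rw [inner_sub_right, inner_sub_right] at hn
    linarith
  have hNR : ∀ i, NonResonant k b (θ i).2.2 →
      Tendsto (fun n => inner ℝ (vec n (powHarmonic k (θ i))) (G n)) F (𝓝 0) := fun i hi =>
    (decorrelates_powHarmonic hi.1 hi.2).tendsto_inner hk hF hFb hGbd
  -- Suppose `b` resonates with `j ≠ i₀`. Then all other correlations vanish, including the one with
  -- `G0`, and `2 ⟪G_j, G⟫ - ‖G‖² ≤ ‖G_j‖²` turns the basic inequality into `‖G0‖² ≤ ‖G_j‖² + o(1)`.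
  -- In the limit this contradicts the strict ordering of amplitudes.
  have hall : ∀ i ∈ J.erase i₀, NonResonant k b (θ i).2.2 := by
    intro j hj
    by_contra hjr
    have hother : ∀ i, i ≠ j → NonResonant k b (θ i).2.2 := fun i hij =>
      (hsep.nonResonant b hb i j hij).resolve_right hjr
    have hji₀ := Finset.ne_of_mem_erase hj
    have hrest : Tendsto (fun n => ∑ i ∈ (J.erase i₀).erase j,
        inner ℝ (vec n (powHarmonic k (θ i))) (G n)) F (𝓝 0) := by
      simpa using tendsto_finsetSum ((J.erase i₀).erase j) fun i hi =>
        hNR i (hother i (Finset.ne_of_mem_erase hi))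
    have h0 := hNR i₀ (hother i₀ hji₀.symm)
    have hle : ∀ᶠ n in F, ‖G0 n‖ ^ 2 ≤ ‖vec n (powHarmonic k (θ j))‖ ^ 2 +
        (2 * inner ℝ (G0 n) (G n) + 2 * ∑ i ∈ (J.erase i₀).erase j,
          inner ℝ (vec n (powHarmonic k (θ i))) (G n) + err n) := by
      filter_upwards [hineq2] with n hn
      rw [← Finset.add_sum_erase _ _ hj, norm_sub_sq_real, real_inner_comm] at hn
      have h1 := sq_nonneg ‖vec n (powHarmonic k (θ j)) - G n‖
      have h2 := norm_sub_sq_real (vec n (powHarmonic k (θ j))) (G n)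
      have h3 : 0 ≤ ‖vec n (powHarmonic k (θ j)) - G n‖ ^ 2 := sq_nonneg _
      linarith
    have hlim := le_of_tendsto_of_tendsto
      ((hsep.phaseVanishes_two_mul i₀).tendsto_norm_vec_sq hF)
      (((hsep.phaseVanishes_two_mul j).tendsto_norm_vec_sq hF).add
        (((h0.const_mul 2).add (hrest.const_mul 2)).add herr0)) hle
    have := hamp j (Finset.mem_of_mem_erase hj) hji₀
    linarith
  have hD : Tendsto (fun n => ‖G n - G0 n‖) F (𝓝 0) := by
    have h1 : Tendsto (fun n =>
        2 * (∑ i ∈ J.erase i₀, inner ℝ (vec n (powHarmonic k (θ i))) (G n)) + err n) F (𝓝 0) := by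
      simpa using ((tendsto_finsetSum (J.erase i₀) fun i hi => hNR i (hall i hi)).const_mul 2).add
        herr0
    have h2 := (squeeze_zero' (Eventually.of_forall fun _ => sq_nonneg _) hineq2 h1).sqrt
    simpa [Real.sqrt_sq (norm_nonneg _)] using h2
  exact ⟨hD, tendsto_of_tendsto_norm_vec_sub hk hF hb hFb (hsep.mem_Ioo i₀) hpos
    (hsep.phaseVanishes_two_mul i₀) (hsep.resonant b hb i₀) hD⟩

/-! ### Separation for sinusoids and for chirps. -/

lemma exp_I_mul_ne_one {γ : ℝ} (h0 : γ ≠ 0) (h1 : -(2 * Real.pi) < γ) (h2 : γ < 2 * Real.pi) :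
    Complex.exp (Complex.I * γ) ≠ 1 := by
  intro h
  rw [Complex.exp_eq_one_iff] at h
  obtain ⟨m, hm⟩ := h
  have h3 : γ = m * (2 * Real.pi) := by
    have : Complex.I * (γ : ℂ) = Complex.I * ((m * (2 * Real.pi) : ℝ) : ℂ) := by
      rw [hm]; push_cast; ring
    exact_mod_cast mul_left_cancel₀ Complex.I_ne_zero this
  have hpi := Real.pi_pos
  have hm1 : (-1 : ℝ) < m := by nlinarith
  have hm2 : (m : ℝ) < 1 := by nlinarith
  have : m = 0 := by
    have a1 : (-1 : ℤ) < m := by exact_mod_cast hm1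
    have a2 : m < (1 : ℤ) := by exact_mod_cast hm2
    omega
  rw [this] at h3
  exact h0 (by simpa using h3)

/-- Sums `b + β i` lie strictly between `0` and `2π`, so `b` can resonate with `β i` only by
equality, and injectivity does the rest. -/
lemma separatedFrequencies_one {ι : Type*} {β : ι → ℝ} (hβ : ∀ i, β i ∈ Set.Ioo 0 Real.pi)
    (hinj : Function.Injective β) : SeparatedFrequencies 1 β := by
  have hpi := Real.pi_pos
  have hadd : ∀ b ∈ Set.Icc 0 Real.pi, ∀ i, PhaseVanishes 1 (b + β i) := fun b hb i =>
    phaseVanishes_one (exp_I_mul_ne_one (by linarith [hb.1, (hβ i).1])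
      (by linarith [hb.1, (hβ i).1]) (by linarith [hb.2, (hβ i).2]))
  have hNR : ∀ b ∈ Set.Icc 0 Real.pi, ∀ i, b ≠ β i → NonResonant 1 b (β i) := fun b hb i hne =>
    ⟨hadd b hb i, phaseVanishes_one (exp_I_mul_ne_one (sub_ne_zero.2 hne)
      (by linarith [hb.1, (hβ i).2]) (by linarith [hb.2, (hβ i).1]))⟩
  refine ⟨hβ, fun b hb i j hij => ?_, fun b hb i => ?_⟩
  · by_cases h : b = β i
    · exact Or.inr (hNR b hb j fun h' => hij (hinj (h.symm.trans h')))
    · exact Or.inl (hNR b hb i h)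
  · by_cases h : b = β i
    · refine Or.inr ⟨?_, Or.inl (hadd b hb i)⟩
      have := hadd b hb i
      rwa [← h, ← two_mul] at this
    · exact Or.inl (hNR b hb i h)

lemma exists_rat_mul_pi_of_not_irrational {x : ℝ} (h : ¬ Irrational (x / Real.pi)) :
    ∃ r : ℚ, x = r * Real.pi := by
  obtain ⟨r, hr⟩ := not_not.1 h
  exact ⟨r, by rw [hr, div_mul_cancel₀ _ Real.pi_ne_zero]⟩

lemma Irrational.ne_rat_mul_pi {x : ℝ} (h : Irrational (x / Real.pi)) (r : ℚ) :
    x ≠ r * Real.pi := by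
  rintro rfl
  rw [mul_div_cancel_right₀ _ Real.pi_ne_zero] at h
  exact h ⟨r, rfl⟩

lemma exists_rat_of_not_nonResonant {b β : ℝ} (h : ¬ NonResonant 2 b β) :
    ∃ r : ℚ, b + β = r * Real.pi ∨ b - β = r * Real.pi := by
  by_contra! hcon
  refine h ⟨phaseVanishes_two ?_, phaseVanishes_two ?_⟩ <;>
  · by_contra h'
    obtain ⟨r, hr⟩ := exists_rat_mul_pi_of_not_irrational h'
    first
    | exact (hcon r).1 hr
    | exact (hcon r).2 hr

/-- Resonance of `b` with `β i` means that `b + β i` or `b - β i` is a rational multiple of `π`.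
Resonance with two rates would make their sum or difference such a multiple. With one rate,
rationality of `2 * b`, or of both `b + β i` and `b - β i`, would make `β i` itself one. -/
lemma separatedFrequencies_two {ι : Type*} {β : ι → ℝ} (hβ : ∀ i, β i ∈ Set.Ioo 0 Real.pi)
    (hirr : ∀ i, Irrational (β i / Real.pi)) (hpair : ∀ i j, i ≠ j →
      Irrational ((β i + β j) / Real.pi) ∧ Irrational ((β i - β j) / Real.pi)) :
    SeparatedFrequencies 2 β := by
  refine ⟨hβ, fun b _ i j hij => ?_, fun b _ i => ?_⟩
  · by_contra! hcon
    obtain ⟨r, hr⟩ := exists_rat_of_not_nonResonant hcon.1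
    obtain ⟨s, hs⟩ := exists_rat_of_not_nonResonant hcon.2
    obtain ⟨h1, h2⟩ := hpair i j hij
    rcases hr with hr | hr <;> rcases hs with hs | hs
    · exact h2.ne_rat_mul_pi (r - s) (by push_cast; linarith)
    · exact h1.ne_rat_mul_pi (r - s) (by push_cast; linarith)
    · exact h1.ne_rat_mul_pi (s - r) (by push_cast; linarith)
    · exact h2.ne_rat_mul_pi (s - r) (by push_cast; linarith)
  · by_cases hNR : NonResonant 2 b (β i)
    · exact Or.inl hNR
    obtain ⟨r, hr⟩ := exists_rat_of_not_nonResonant hNR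
    refine Or.inr ⟨phaseVanishes_two ?_, ?_⟩
    · by_contra h
      obtain ⟨s, hs⟩ := exists_rat_mul_pi_of_not_irrational h
      rcases hr with hr | hr
      · exact (hirr i).ne_rat_mul_pi (r - s / 2) (by push_cast; linarith)
      · exact (hirr i).ne_rat_mul_pi (s / 2 - r) (by push_cast; linarith)
    · by_contra! hcon
      have h1 : ¬ Irrational ((b + β i) / Real.pi) := fun h => hcon.1 (phaseVanishes_two h)
      have h2 : ¬ Irrational ((b - β i) / Real.pi) := fun h => hcon.2 (phaseVanishes_two h)
      obtain ⟨s, hs⟩ := exists_rat_mul_pi_of_not_irrational h1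
      obtain ⟨u, hu⟩ := exists_rat_mul_pi_of_not_irrational h2
      exact (hirr i).ne_rat_mul_pi ((s - u) / 2) (by push_cast; linarith)

/-! ### Interpolation between eighth powers and sums over innovations. -/

lemma exists_pow_eight_le_lt (n : ℕ) : ∃ m : ℕ, m ^ 8 ≤ n ∧ n < (m + 1) ^ 8 := by
  have h : ∃ m, n < (m + 1) ^ 8 :=
    ⟨n, (Nat.lt_succ_self n).trans_le (Nat.le_self_pow (by norm_num) _)⟩
  refine ⟨Nat.find h, ?_, Nat.find_spec h⟩
  rcases Nat.eq_zero_or_pos (Nat.find h) with h0 | h0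
  · rw [h0]; simp
  · have := Nat.find_min h (Nat.sub_lt h0 one_pos)
    have e : Nat.find h - 1 + 1 = Nat.find h := by omega
    rw [e] at this
    exact not_lt.1 this

lemma mul_pow_eight_gap_le {m : ℕ} (hm : 1 ≤ m) :
    (m : ℝ) * (((m + 1 : ℕ) : ℝ) ^ 8 - (m : ℝ) ^ 8) ≤ 255 * (m : ℝ) ^ 8 := by
  have hm' : (1 : ℝ) ≤ m := by exact_mod_cast hm
  set x : ℝ := (m : ℝ)
  have h : ∀ i ≤ 7, x ^ i ≤ x ^ 7 := fun i hi => pow_le_pow_right₀ hm' hi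
  have key : ((m + 1 : ℕ) : ℝ) ^ 8 - x ^ 8 ≤ 255 * x ^ 7 := by
    push_cast
    have := h 0 (by norm_num)
    have := h 1 (by norm_num)
    have := h 2 (by norm_num)
    have := h 3 (by norm_num)
    have := h 4 (by norm_num)
    have := h 5 (by norm_num)
    have := h 6 (by norm_num)
    have e : (x + 1) ^ 8 - x ^ 8 = 8 * x ^ 7 + 28 * x ^ 6 + 56 * x ^ 5 + 70 * x ^ 4 + 56 * x ^ 3 +
      28 * x ^ 2 + 8 * x ^ 1 + x ^ 0 := by ring
    change (x + 1) ^ 8 - x ^ 8 ≤ _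
    linarith
  calc x * (((m + 1 : ℕ) : ℝ) ^ 8 - x ^ 8) ≤ x * (255 * x ^ 7) := by gcongr
    _ = 255 * x ^ 8 := by ring

lemma sum_Icc_one_add_sum_Ioc {E : Type*} [AddCommMonoid E] (f : ℕ → E) {l n : ℕ} (h : l ≤ n) :
    ∑ t ∈ Finset.Icc 1 l, f t + ∑ t ∈ Finset.Ioc l n, f t = ∑ t ∈ Finset.Icc 1 n, f t := by
  have h1 : ∀ l, Finset.Icc 1 l = Finset.Ioc 0 l := fun l => by ext; simp [Nat.succ_le_iff]
  rw [h1, h1, Finset.sum_Ioc_consecutive _ (Nat.zero_le _) h]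

lemma le_half_add_div {x c : ℝ} (hc : 0 < c) : x ≤ (c + x ^ 2 / c) / 2 := by
  have : 0 ≤ (x - c) ^ 2 / c := by positivity
  have e : (x - c) ^ 2 / c = x ^ 2 / c - 2 * x + c := by field_simp; ring
  linarith

/-- Transfer of decorrelation from the innovations to a linear process, along a path on which
weighted sums of quadratic bounds vanish along the eighth powers. -/
lemma decorrelates_of_hasSum {k : ℕ} {a : ℤ → ℝ} (ha : Summable fun j => |a j|)
    {x : ℤ → ℕ → ℝ} {X : ℕ → ℝ} (hX : ∀ t, HasSum (fun j => a j * x j t) (X t))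
    {R : ℕ → ℤ → ℝ}
    (hmain : ∀ (m : ℕ) j β, ‖∑ t ∈ Finset.Icc 1 (m ^ 8), (x j t : ℂ) * unitPhase k β t‖ ^ 2 ≤
      ((m : ℝ) ^ 8) ^ 2 * R m j)
    (hgap : ∀ (m : ℕ) j, 1 ≤ m → ∑ t ∈ Finset.Ioc (m ^ 8) ((m + 1) ^ 8), x j t ^ 2 ≤
      m * (m : ℝ) ^ 8 * R m j)
    (hRs : ∀ᶠ m in atTop, Summable fun j => |a j| * R m j)
    (hRt : Tendsto (fun m => ∑' j, |a j| * R m j) atTop (𝓝 0)) (β : ℝ) :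
    Decorrelates k X β := by
  set A := ∑' j, |a j| with hA
  have hA0 : 0 ≤ A := tsum_nonneg fun _ => abs_nonneg _
  refine Metric.tendsto_nhds.2 fun ε hε => ?_
  obtain ⟨δ, hδ, hδε⟩ : ∃ δ : ℝ, 0 < δ ∧ δ * (128 * A + 1) < ε := by
    refine ⟨ε / (2 * (128 * A + 1)), by positivity, ?_⟩
    have : ε / (2 * (128 * A + 1)) * (128 * A + 1) = ε / 2 := by field_simp
    rw [this]; linarith
  obtain ⟨m₀, hm₀⟩ := eventually_atTop.1 (hRs.and (hRt.eventually_le_const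
    (by positivity : 0 < δ ^ 2)))
  have hn : ∀ᶠ n : ℕ in atTop, ∀ b, ‖(∑ t ∈ Finset.Icc 1 n, (X t : ℂ) * unitPhase k b t)‖ ≤
      δ * (128 * A + 1) * n := by
    filter_upwards [eventually_ge_atTop ((m₀ + 1) ^ 8)] with n hn b
    obtain ⟨m, hm1, hm2⟩ := exists_pow_eight_le_lt n
    have hmm : m₀ ≤ m ∧ 1 ≤ m := by
      have := lt_of_pow_lt_pow_left₀ 8 (by omega) (hn.trans_lt hm2)
      omega
    obtain ⟨hsum, hρ⟩ := hm₀ m (by omega)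
    have hm1' : (1 : ℝ) ≤ m := by exact_mod_cast hmm.2
    set N : ℝ := (m : ℝ) ^ 8 with hN
    have hN0 : 0 < N := by positivity
    have hNn : N ≤ n := by rw [hN]; exact_mod_cast hm1
    -- The inequality `x ≤ (c + x ^ 2 / c) / 2` makes the bound linear in `R m j`, so it can be
    -- summed against `|a j|`. Here `c` is `δ * N` for the main block and `δ * m` for each term of
    -- the gap, and `128 = (1 + 255) / 2`.
    have hSj : ∀ j, ‖∑ t ∈ Finset.Icc 1 n, (x j t : ℂ) * unitPhase k b t‖ ≤
        128 * δ * N + N / δ * R m j := by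
      intro j
      have hsplit : ∑ t ∈ Finset.Icc 1 n, (x j t : ℂ) * unitPhase k b t =
          ∑ t ∈ Finset.Icc 1 (m ^ 8), (x j t : ℂ) * unitPhase k b t +
          ∑ t ∈ Finset.Ioc (m ^ 8) n, (x j t : ℂ) * unitPhase k b t :=
        (sum_Icc_one_add_sum_Ioc _ hm1).symm
      have hfirst : ‖∑ t ∈ Finset.Icc 1 (m ^ 8), (x j t : ℂ) * unitPhase k b t‖ ≤
          (δ * N + N * R m j / δ) / 2 := by
        refine (le_half_add_div (by positivity : 0 < δ * N)).trans ?_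
        have : ‖∑ t ∈ Finset.Icc 1 (m ^ 8), (x j t : ℂ) * unitPhase k b t‖ ^ 2 / (δ * N) ≤
            N ^ 2 * R m j / (δ * N) := by gcongr; exact hmain m j b
        have e : N ^ 2 * R m j / (δ * N) = N * R m j / δ := by field_simp
        linarith
      have hsecond : ‖∑ t ∈ Finset.Ioc (m ^ 8) n, (x j t : ℂ) * unitPhase k b t‖ ≤
          (255 * δ * N + N * R m j / δ) / 2 := by
        calc _ ≤ ∑ t ∈ Finset.Ioc (m ^ 8) n, |x j t| := by
              refine (norm_sum_le _ _).trans (le_of_eq (Finset.sum_congr rfl fun t _ => ?_))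
              simp
          _ ≤ ∑ t ∈ Finset.Ioc (m ^ 8) ((m + 1) ^ 8), |x j t| :=
              Finset.sum_le_sum_of_subset_of_nonneg (Finset.Ioc_subset_Ioc_right hm2.le)
                fun _ _ _ => abs_nonneg _
          _ ≤ ∑ t ∈ Finset.Ioc (m ^ 8) ((m + 1) ^ 8), (δ * m + x j t ^ 2 / (δ * m)) / 2 :=
              Finset.sum_le_sum fun t _ => by
                have := le_half_add_div (x := |x j t|) (by positivity : 0 < δ * (m : ℝ))
                rwa [sq_abs] at this
          _ = (δ * (m * (((m + 1 : ℕ) : ℝ) ^ 8 - (m : ℝ) ^ 8)) +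
                (∑ t ∈ Finset.Ioc (m ^ 8) ((m + 1) ^ 8), x j t ^ 2) / (δ * m)) / 2 := by
              rw [← Finset.sum_div, Finset.sum_add_distrib, ← Finset.sum_div]
              have hle : m ^ 8 ≤ (m + 1) ^ 8 := Nat.pow_le_pow_left (by omega) 8
              simp only [Finset.sum_const, Nat.card_Ioc, nsmul_eq_mul]
              rw [Nat.cast_sub hle]
              push_cast
              ring
          _ ≤ (δ * (255 * N) + (m * N * R m j) / (δ * m)) / 2 := by
              have g1 := mul_le_mul_of_nonneg_left (mul_pow_eight_gap_le hmm.2) hδ.le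
              have g2 := div_le_div_of_nonneg_right (hgap m j hmm.2)
                (by positivity : 0 ≤ δ * (m : ℝ))
              linarith
          _ = _ := by field_simp
      rw [hsplit]
      refine (norm_add_le _ _).trans ((add_le_add hfirst hsecond).trans (le_of_eq ?_))
      field_simp; ring
    have hS : HasSum (fun j => (a j : ℂ) * ∑ t ∈ Finset.Icc 1 n, (x j t : ℂ) * unitPhase k b t)
        (∑ t ∈ Finset.Icc 1 n, (X t : ℂ) * unitPhase k b t) := by
      have h1 : ∀ t ∈ Finset.Icc 1 n, HasSum (fun j => ((a j * x j t : ℝ) : ℂ) * unitPhase k b t)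
          ((X t : ℂ) * unitPhase k b t) := fun t _ =>
        (Complex.hasSum_ofReal.2 (hX t)).mul_right _
      convert hasSum_sum h1 using 2 with j
      rw [Finset.mul_sum]
      refine Finset.sum_congr rfl fun t _ => ?_
      push_cast; ring
    have hB : HasSum (fun j => 128 * δ * N * |a j| + N / δ * (|a j| * R m j))
        (128 * δ * N * A + N / δ * ∑' j, |a j| * R m j) :=
      (ha.hasSum.mul_left _).add (hsum.hasSum.mul_left _)
    refine (hS.norm_le_of_bounded hB fun j => ?_).trans ?_
    · rw [norm_mul, Complex.norm_real, Real.norm_eq_abs]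
      calc _ ≤ |a j| * (128 * δ * N + N / δ * R m j) := by gcongr; exact hSj j
        _ = _ := by ring
    · calc _ ≤ 128 * δ * N * A + N / δ * δ ^ 2 := by gcongr
        _ = δ * (128 * A + 1) * N := by field_simp
        _ ≤ _ := by gcongr
  filter_upwards [tendsto_fst.eventually hn] with p hp
  rw [dist_zero_right, norm_div, Complex.norm_natCast]
  exact (div_le_of_le_mul₀ (by positivity) (by positivity) (hp p.2)).trans_lt hδε

/-! ### Frequency-free bounds for exponential sums. -/

/-- Expansion of the square by lag `h`. Unlike the version with finitely many shifts, all lags are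
kept, so that the frequency can be eliminated lag by lag. -/
lemma norm_sum_sq_eq (v : ℕ → ℂ) (N : ℕ) :
    ‖∑ t ∈ Finset.Icc 1 N, v t‖ ^ 2 = ∑ t ∈ Finset.Icc 1 N, ‖v t‖ ^ 2 +
      2 * (∑ h ∈ Finset.Ico 1 N, ∑ t ∈ Finset.Icc 1 (N - h),
        v (t + h) * (starRingEnd ℂ) (v t)).re := by
  induction N with
  | zero => simp
  | succ N ih =>
    have h1 : ∑ h ∈ Finset.Ico 1 (N + 1), ∑ t ∈ Finset.Icc 1 (N + 1 - h),
        v (t + h) * (starRingEnd ℂ) (v t) =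
        ∑ h ∈ Finset.Ico 1 N, ∑ t ∈ Finset.Icc 1 (N - h), v (t + h) * (starRingEnd ℂ) (v t) +
        v (N + 1) * (starRingEnd ℂ) (∑ t ∈ Finset.Icc 1 N, v t) := by
      have e1 : ∀ h ∈ Finset.Ico 1 (N + 1), ∑ t ∈ Finset.Icc 1 (N + 1 - h),
          v (t + h) * (starRingEnd ℂ) (v t) =
          ∑ t ∈ Finset.Icc 1 (N - h), v (t + h) * (starRingEnd ℂ) (v t) +
          v (N + 1) * (starRingEnd ℂ) (v (N + 1 - h)) := by
        intro h hh
        rw [Finset.mem_Ico] at hh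
        rw [show N + 1 - h = (N - h) + 1 by omega, Finset.sum_Icc_succ_top (by omega),
          show N - h + 1 + h = N + 1 by omega]
      rw [Finset.sum_congr rfl e1, Finset.sum_add_distrib]
      congr 1
      · rcases Nat.eq_zero_or_pos N with rfl | hN
        · simp
        · rw [Finset.sum_Ico_succ_top hN]; simp
      · rw [map_sum, Finset.mul_sum]
        refine Finset.sum_nbij' (fun h => N + 1 - h) (fun h => N + 1 - h) ?_ ?_ ?_ ?_ ?_ <;>
          intro h hh <;> simp only [Finset.mem_Ico, Finset.mem_Icc] at * <;> first | rfl | omega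
    rw [h1, Finset.sum_Icc_succ_top (by omega), Finset.sum_Icc_succ_top (by omega), Complex.add_re,
      mul_add, ← Complex.normSq_eq_norm_sq, Complex.normSq_add, Complex.normSq_eq_norm_sq, ih,
      Complex.normSq_eq_norm_sq]
    have : ((∑ t ∈ Finset.Icc 1 N, v t) * (starRingEnd ℂ) (v (N + 1))).re =
        (v (N + 1) * (starRingEnd ℂ) (∑ t ∈ Finset.Icc 1 N, v t)).re := by
      simp only [Complex.mul_re, Complex.conj_re, Complex.conj_im]; ring
    rw [this]; ring

lemma norm_sum_sq_le (v : ℕ → ℂ) (N : ℕ) :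
    ‖∑ t ∈ Finset.Icc 1 N, v t‖ ^ 2 ≤ ∑ t ∈ Finset.Icc 1 N, ‖v t‖ ^ 2 +
      2 * ∑ h ∈ Finset.Ico 1 N, ‖∑ t ∈ Finset.Icc 1 (N - h),
        v (t + h) * (starRingEnd ℂ) (v t)‖ := by
  rw [norm_sum_sq_eq]
  gcongr
  exact (Complex.re_le_norm _).trans (norm_sum_le _ _)

/-- A bound, free of the frequency, for the squared modulus of `∑ x(t) exp(i α t)`. -/
noncomputable def corrBound (x : ℕ → ℝ) (N : ℕ) : ℝ :=
  ∑ t ∈ Finset.Icc 1 N, x t ^ 2 +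
    2 * ∑ h ∈ Finset.Ico 1 N, |∑ t ∈ Finset.Icc 1 (N - h), x (t + h) * x t|

/-- A bound, free of the frequency, for the squared modulus of `∑ x(t) exp(i β t ^ 2)`. -/
noncomputable def chirpCorrBound (x : ℕ → ℝ) (N : ℕ) : ℝ :=
  ∑ t ∈ Finset.Icc 1 N, x t ^ 2 +
    2 * ∑ h ∈ Finset.Ico 1 N, √(corrBound (fun t => x (t + h) * x t) (N - h))

lemma corrBound_nonneg (x : ℕ → ℝ) (N : ℕ) : 0 ≤ corrBound x N := by
  unfold corrBound; positivity

lemma chirpCorrBound_nonneg (x : ℕ → ℝ) (N : ℕ) : 0 ≤ chirpCorrBound x N := by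
  unfold chirpCorrBound; positivity

/-- In the lag-`h` correlation the phase is the constant `exp(iαh)`, which disappears under the
norm. -/
lemma norm_sum_mul_unitPhase_one_sq_le (x : ℕ → ℝ) (N : ℕ) (α : ℝ) :
    ‖∑ t ∈ Finset.Icc 1 N, (x t : ℂ) * unitPhase 1 α t‖ ^ 2 ≤ corrBound x N := by
  refine (norm_sum_sq_le _ N).trans (le_of_eq ?_)
  unfold corrBound
  congr 1
  · exact Finset.sum_congr rfl fun t _ => by simp
  · congr 1
    refine Finset.sum_congr rfl fun h _ => ?_
    have : ∀ t, (x (t + h) : ℂ) * unitPhase 1 α (t + h) *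
        (starRingEnd ℂ) ((x t : ℂ) * unitPhase 1 α t) =
        unitPhase 1 α h * ((x (t + h) * x t : ℝ) : ℂ) := by
      intro t
      have e : unitPhase 1 α (t + h) * unitPhase 1 (-α) t = unitPhase 1 α h := by
        simp only [unitPhase, ← Complex.exp_add]
        congr 1; push_cast; ring
      rw [map_mul, conj_unitPhase, Complex.conj_ofReal, ← e]
      push_cast; ring
    simp_rw [this]
    rw [← Finset.mul_sum, norm_mul, norm_unitPhase, one_mul, ← Complex.ofReal_sum,
      Complex.norm_real, Real.norm_eq_abs]

/-- At lag `h` a quadratic phase becomes a linear one of frequency `2βh`, to which the bound for `k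
= 1` applies; two differencings remove `β`. -/
lemma norm_sum_mul_unitPhase_two_sq_le (x : ℕ → ℝ) (N : ℕ) (β : ℝ) :
    ‖∑ t ∈ Finset.Icc 1 N, (x t : ℂ) * unitPhase 2 β t‖ ^ 2 ≤ chirpCorrBound x N := by
  refine (norm_sum_sq_le _ N).trans ?_
  unfold chirpCorrBound
  refine add_le_add (le_of_eq (Finset.sum_congr rfl fun t _ => by simp)) ?_
  gcongr with h hh
  refine Real.le_sqrt_of_sq_le ?_
  have : ∀ t, (x (t + h) : ℂ) * unitPhase 2 β (t + h) *
      (starRingEnd ℂ) ((x t : ℂ) * unitPhase 2 β t) =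
      unitPhase 2 β h * (((x (t + h) * x t : ℝ) : ℂ) * unitPhase 1 (2 * β * h) t) := by
    intro t
    have e : unitPhase 2 β (t + h) * unitPhase 2 (-β) t =
        unitPhase 2 β h * unitPhase 1 (2 * β * h) t := by
      simp only [unitPhase, ← Complex.exp_add]
      congr 1; push_cast; ring
    rw [map_mul, conj_unitPhase, Complex.conj_ofReal]
    push_cast
    linear_combination (x (t + h) : ℂ) * x t * e
  simp_rw [this]
  rw [← Finset.mul_sum, norm_mul, norm_unitPhase, one_mul]
  exact norm_sum_mul_unitPhase_one_sq_le _ _ _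

/-! ### Moments of the bounds for white noise. -/

lemma integral_abs_le_sqrt {Ω : Type*} [MeasurableSpace Ω] {μ : Measure Ω}
    [IsProbabilityMeasure μ] {f : Ω → ℝ} (hf : MemLp f 2 μ) :
    ∫ ω, |f ω| ∂μ ≤ √(∫ ω, f ω ^ 2 ∂μ) := by
  refine Real.le_sqrt_of_sq_le ?_
  have h1 := variance_nonneg |f| μ
  rw [variance_eq_sub hf.abs] at h1
  simp only [Pi.pow_apply, Pi.abs_apply, sq_abs] at h1
  linarith

/-- One exceptional lag `h₀` is allowed a larger moment `e`: for the products `x (t + h) * x t`, the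
lag `h` repeats an index and orthogonality would need fourth moments. -/
lemma corrBound_moment {Ω : Type*} [MeasurableSpace Ω] {μ : Measure Ω} {f : ℕ → Ω → ℝ}
    {c b e : ℝ} {h₀ N : ℕ} (hf : ∀ t, MemLp (f t) 2 μ)
    (hb : 0 ≤ b) (he : 0 ≤ e) (hc : ∀ t, ∫ ω, f t ω ^ 2 ∂μ = c)
    (hcorr : ∀ h ∈ Finset.Ico 1 N, ∫ ω, |∑ t ∈ Finset.Icc 1 (N - h), f (t + h) ω * f t ω| ∂μ ≤
      b + if h = h₀ then e else 0) :
    Integrable (fun ω => corrBound (fun t => f t ω) N) μ ∧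
      ∫ ω, corrBound (fun t => f t ω) N ∂μ ≤ N * c + 2 * (N * b + e) := by
  have i1 : Integrable (fun ω => ∑ t ∈ Finset.Icc 1 N, f t ω ^ 2) μ :=
    integrable_finsetSum _ fun t _ => (hf t).integrable_sq
  have i2 : ∀ h, Integrable (fun ω => |∑ t ∈ Finset.Icc 1 (N - h), f (t + h) ω * f t ω|) μ :=
    fun h => (integrable_finsetSum _ fun t _ => (hf (t + h)).integrable_mul (hf t)).abs
  have i3 : Integrable (fun ω => ∑ h ∈ Finset.Ico 1 N,
      |∑ t ∈ Finset.Icc 1 (N - h), f (t + h) ω * f t ω|) μ :=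
    integrable_finsetSum _ fun h _ => i2 h
  refine ⟨i1.add (i3.const_mul 2), ?_⟩
  simp only [corrBound]
  rw [integral_add i1 (i3.const_mul 2), integral_const_mul,
    integral_finsetSum _ fun t _ => (hf t).integrable_sq, integral_finsetSum _ fun h _ => i2 h]
  have e1 : ∑ t ∈ Finset.Icc 1 N, ∫ ω, f t ω ^ 2 ∂μ = N * c := by simp [hc]
  have e2 : ∑ h ∈ Finset.Ico 1 N, ∫ ω, |∑ t ∈ Finset.Icc 1 (N - h), f (t + h) ω * f t ω| ∂μ ≤
      N * b + e := by
    refine (Finset.sum_le_sum hcorr).trans ?_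
    rw [Finset.sum_add_distrib, Finset.sum_ite_eq']
    have : ((N - 1 : ℕ) : ℝ) ≤ N := by exact_mod_cast Nat.sub_le N 1
    simp only [Finset.sum_const, Nat.card_Ico, nsmul_eq_mul]
    refine add_le_add (by gcongr) ?_
    split_ifs <;> simp [he]
  linarith

/-- Independent centred square integrable variables with common second moment `s`. -/
structure IsWhiteNoise {Ω : Type*} [MeasurableSpace Ω] (μ : Measure Ω) (x : ℕ → Ω → ℝ)
    (s : ℝ) : Prop where
  indep : iIndepFun x μ
  memLp : ∀ t, MemLp (x t) 2 μ
  mean_eq_zero : ∀ t, ∫ ω, x t ω ∂μ = 0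
  integral_sq : ∀ t, ∫ ω, x t ω ^ 2 ∂μ = s

namespace IsWhiteNoise

variable {Ω : Type*} [MeasurableSpace Ω] {μ : Measure Ω} {x : ℕ → Ω → ℝ} {s : ℝ}

lemma nonneg (hx : IsWhiteNoise μ x s) : 0 ≤ s := by
  rw [← hx.integral_sq 0]
  exact integral_nonneg fun _ => sq_nonneg _

lemma aemeasurable (hx : IsWhiteNoise μ x s) (t : ℕ) : AEMeasurable (x t) μ :=
  (hx.memLp t).1.aemeasurable

/-- The index `i` occurs exactly once, so its factor is independent of the rest and has mean zero.
The auxiliary `y j` is a function of `x j` alone, which keeps the family independent. -/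
lemma integral_prod_mul_prod (hx : IsWhiteNoise μ x s) {I J : Finset ℕ} {i : ℕ} (hI : i ∈ I)
    (hJ : i ∉ J) : ∫ ω, (∏ j ∈ I, x j ω) * ∏ j ∈ J, x j ω ∂μ = 0 := by
  set y : ℕ → Ω → ℝ := fun j ω => (if j ∈ I then x j ω else 1) * (if j ∈ J then x j ω else 1)
    with hy
  have hyind : iIndepFun y μ :=
    hx.indep.comp (fun j r => (if j ∈ I then r else 1) * (if j ∈ J then r else 1)) fun j => by
      split_ifs <;> fun_prop
  have hym : ∀ j, AEMeasurable (y j) μ := fun j => by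
    have := hx.aemeasurable j
    simp only [hy]
    split_ifs <;> fun_prop
  have hind : IndepFun (∏ j ∈ (I ∪ J).erase i, y j) (y i) μ :=
    hyind.indepFun_finsetProd_of_notMem₀ hym (by simp)
  have h3 := hind.integral_mul_eq_mul_integral
    (Finset.aemeasurable_prod _ fun j _ => hym j).aestronglyMeasurable (hym i).aestronglyMeasurable
  have hyi : y i = x i := by funext ω; simp [hy, hI, hJ]
  rw [hyi, hx.mean_eq_zero i, mul_zero, ← hyi] at h3
  rw [← h3]
  refine integral_congr_ae (Eventually.of_forall fun ω => ?_)
  simp only [Pi.mul_apply, Finset.prod_apply]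
  rw [Finset.prod_erase_mul _ _ (Finset.mem_union_left _ hI)]
  simp only [hy, Finset.prod_mul_distrib]
  congr 1
  · rw [Finset.prod_ite_mem, Finset.union_inter_cancel_left]
  · rw [Finset.prod_ite_mem, Finset.union_inter_cancel_right]

lemma sqrt_natCast_mul_le (hx : IsWhiteNoise μ x s) {M N : ℕ} (hMN : M ≤ N) (d : ℕ) :
    √(M * s ^ (2 * d)) ≤ √(N : ℝ) * s ^ d := by
  have hs := hx.nonneg
  rw [Real.sqrt_mul (by positivity), pow_mul', Real.sqrt_sq (by positivity)]
  gcongr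

variable [IsProbabilityMeasure μ]

lemma integrable_prod_sq (hx : IsWhiteNoise μ x s) (I : Finset ℕ) :
    Integrable (fun ω => ∏ i ∈ I, x i ω ^ 2) μ ∧ ∫ ω, ∏ i ∈ I, x i ω ^ 2 ∂μ = s ^ I.card := by
  set y : ℕ → Ω → ℝ := fun i ω => x i ω ^ 2 with hy
  have hyind : iIndepFun y μ := hx.indep.comp (fun _ r => r ^ 2) fun _ => by fun_prop
  have hym : ∀ i, AEMeasurable (y i) μ := fun i => (hx.aemeasurable i).pow_const 2
  induction I using Finset.induction_on with
  | empty => simp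
  | insert i I hi ih =>
    have hind : IndepFun (∏ j ∈ I, y j) (y i) μ := hyind.indepFun_finsetProd_of_notMem₀ hym hi
    have e0 : (∏ j ∈ I, y j) = fun ω => ∏ j ∈ I, x j ω ^ 2 := by
      funext ω; simp [hy, Finset.prod_apply]
    have h1 : Integrable (∏ j ∈ I, y j) μ := by rw [e0]; exact ih.1
    have h2 : Integrable (y i) μ := (hx.memLp i).integrable_sq
    have e : (fun ω => ∏ j ∈ insert i I, x j ω ^ 2) = (∏ j ∈ I, y j) * y i := by
      funext ω; rw [Finset.prod_insert hi, e0]; simp [hy, mul_comm]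
    refine ⟨e ▸ hind.integrable_mul h1 h2, ?_⟩
    have h3 := hind.integral_mul_eq_mul_integral h1.1 h2.1
    rw [← e, e0] at h3
    rw [h3, ih.2, Finset.card_insert_of_notMem hi, pow_succ]
    congr 1
    exact hx.integral_sq i

lemma memLp_prod (hx : IsWhiteNoise μ x s) (I : Finset ℕ) :
    MemLp (fun ω => ∏ i ∈ I, x i ω) 2 μ := by
  refine (memLp_two_iff_integrable_sq ?_).2 ?_
  · exact (Finset.aemeasurable_fun_prod I fun i _ => hx.aemeasurable i).aestronglyMeasurable
  · simpa only [Finset.prod_pow] using (hx.integrable_prod_sq I).1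

/-- The `L¹` norm of a sum of products of the noise over index sets with different minima. -/
lemma integral_abs_sum_prod_le (hx : IsWhiteNoise μ x s) {I : ℕ → Finset ℕ} {d : ℕ}
    (hmem : ∀ t, t ∈ I t) (hmin : ∀ t, ∀ i ∈ I t, t ≤ i) (hcard : ∀ t, (I t).card = d)
    (S : Finset ℕ) :
    ∫ ω, |∑ t ∈ S, ∏ i ∈ I t, x i ω| ∂μ ≤ √(S.card * s ^ d) := by
  have hL : MemLp (fun ω => ∑ t ∈ S, ∏ i ∈ I t, x i ω) 2 μ :=
    memLp_finsetSum S fun t _ => hx.memLp_prod (I t)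
  refine (integral_abs_le_sqrt hL).trans (Real.sqrt_le_sqrt (le_of_eq ?_))
  have hint : ∀ t t', Integrable (fun ω => (∏ i ∈ I t, x i ω) * ∏ i ∈ I t', x i ω) μ :=
    fun t t' => (hx.memLp_prod (I t)).integrable_mul (hx.memLp_prod (I t'))
  simp_rw [sq, Finset.sum_mul_sum]
  rw [integral_finsetSum _ fun t _ => integrable_finsetSum _ fun t' _ => hint t t']
  have : ∀ t ∈ S, ∫ ω, ∑ t' ∈ S, (∏ i ∈ I t, x i ω) * ∏ i ∈ I t', x i ω ∂μ = s ^ d := by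
    intro t ht
    rw [integral_finsetSum _ fun t' _ => hint t t', Finset.sum_eq_single t]
    · rw [← hcard t, ← (hx.integrable_prod_sq (I t)).2]
      simp only [← sq, Finset.prod_pow]
    · intro t' _ hne
      -- The smaller of `t` and `t'` belongs to its own index set and lies below every element of
      -- the other, so the cross term has mean zero.
      rcases lt_or_gt_of_ne hne with h | h
      · have := hx.integral_prod_mul_prod (I := I t') (J := I t) (hmem t')
          fun h' => absurd (hmin t _ h') (by omega)
        simpa only [mul_comm] using this
      · exact hx.integral_prod_mul_prod (hmem t) fun h' => absurd (hmin t' _ h') (by omega)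
    · exact fun h => absurd ht h
  rw [Finset.sum_congr rfl this]
  simp

lemma integral_corrBound_le (hx : IsWhiteNoise μ x s) (N : ℕ) :
    Integrable (fun ω => corrBound (fun t => x t ω) N) μ ∧
      ∫ ω, corrBound (fun t => x t ω) N ∂μ ≤ N * s + 2 * (N * (√(N : ℝ) * s)) := by
  have hs := hx.nonneg
  have := corrBound_moment (N := N) (h₀ := 0) (b := √(N : ℝ) * s) (e := 0) hx.memLp (by positivity)
    le_rfl hx.integral_sq fun h hh => ?_
  · simpa using this
  · rw [Finset.mem_Ico] at hh
    have h1 := hx.integral_abs_sum_prod_le (I := fun t => {t + h, t}) (d := 2) (by simp)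
      (by intro t i hi; simp at hi; omega)
      (by intro t; rw [Finset.card_pair]; omega) (Finset.Icc 1 (N - h))
    have e : ∀ t ω, ∏ i ∈ ({t + h, t} : Finset ℕ), x i ω = x (t + h) ω * x t ω := by
      intro t ω; rw [Finset.prod_pair]; omega
    simp only [e] at h1
    refine h1.trans ?_
    have h2 := hx.sqrt_natCast_mul_le (M := N - h) (N := N) (Nat.sub_le N h) 1
    simp only [mul_one, pow_one] at h2
    simpa using h2

lemma memLp_mul_shift (hx : IsWhiteNoise μ x s) {h : ℕ} (hh : 1 ≤ h) (t : ℕ) :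
    MemLp (fun ω => x (t + h) ω * x t ω) 2 μ := by
  have := hx.memLp_prod {t + h, t}
  simpa [Finset.prod_pair (show t + h ≠ t by omega)] using this

lemma integral_mul_shift_sq (hx : IsWhiteNoise μ x s) {h : ℕ} (hh : 1 ≤ h) (t : ℕ) :
    ∫ ω, (x (t + h) ω * x t ω) ^ 2 ∂μ = s ^ 2 := by
  have := (hx.integrable_prod_sq {t + h, t}).2
  rw [Finset.card_pair (by omega)] at this
  simpa [Finset.prod_pair (show t + h ≠ t by omega), mul_pow] using this

/-- For `l ≠ h` the four indices are distinct and the products are orthogonal, needing only second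
moments. For `l = h` the first moment is bounded by the mean of two squares, which costs order `N`
at that single lag. -/
lemma integral_corrBound_shift_le (hx : IsWhiteNoise μ x s) {h : ℕ} (hh : 1 ≤ h) {M N : ℕ}
    (hMN : M ≤ N) :
    Integrable (fun ω => corrBound (fun t => x (t + h) ω * x t ω) M) μ ∧
      ∫ ω, corrBound (fun t => x (t + h) ω * x t ω) M ∂μ ≤
        N * s ^ 2 + 2 * (N * (√(N : ℝ) * s ^ 2) + N * s ^ 2) := by
  have hs := hx.nonneg
  have hMN' : (M : ℝ) ≤ N := by exact_mod_cast hMN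
  have := corrBound_moment (N := M) (h₀ := h) (b := √(N : ℝ) * s ^ 2) (e := N * s ^ 2)
    (hx.memLp_mul_shift hh) (by positivity) (by positivity) (hx.integral_mul_shift_sq hh)
    fun l hl => ?_
  · refine ⟨this.1, this.2.trans ?_⟩
    gcongr
  · rw [Finset.mem_Ico] at hl
    split_ifs with hlh
    · refine le_add_of_nonneg_of_le (by positivity) ?_
      have h1 : ∀ t, Integrable (fun ω => ((x (t + l + h) ω * x (t + l) ω) ^ 2 +
          (x (t + h) ω * x t ω) ^ 2) / 2) μ := fun t =>
        ((hx.memLp_mul_shift hh (t + l)).integrable_sq.add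
          (hx.memLp_mul_shift hh t).integrable_sq).div_const 2
      calc _ ≤ ∫ ω, ∑ t ∈ Finset.Icc 1 (M - l), ((x (t + l + h) ω * x (t + l) ω) ^ 2 +
            (x (t + h) ω * x t ω) ^ 2) / 2 ∂μ := by
            refine integral_mono_of_nonneg (Eventually.of_forall fun _ => abs_nonneg _)
              (integrable_finsetSum _ fun t _ => h1 t) (Eventually.of_forall fun ω => ?_)
            refine (Finset.abs_sum_le_sum_abs _ _).trans (Finset.sum_le_sum fun t _ => ?_)
            rw [abs_le]
            constructor
            · nlinarith [sq_nonneg (x (t + l + h) ω * x (t + l) ω + x (t + h) ω * x t ω)]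
            · nlinarith [sq_nonneg (x (t + l + h) ω * x (t + l) ω - x (t + h) ω * x t ω)]
        _ = ((M - l : ℕ) : ℝ) * s ^ 2 := by
            rw [integral_finsetSum _ fun t _ => h1 t]
            have : ∀ t, ∫ ω, ((x (t + l + h) ω * x (t + l) ω) ^ 2 +
                (x (t + h) ω * x t ω) ^ 2) / 2 ∂μ = s ^ 2 := by
              intro t
              rw [integral_div, integral_add (hx.memLp_mul_shift hh (t + l)).integrable_sq
                (hx.memLp_mul_shift hh t).integrable_sq, hx.integral_mul_shift_sq hh,
                hx.integral_mul_shift_sq hh]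
              ring
            simp [this]
        _ ≤ N * s ^ 2 := by
            have : ((M - l : ℕ) : ℝ) ≤ N := by exact_mod_cast (Nat.sub_le M l).trans hMN
            gcongr
    · rw [add_zero]
      have e : ∀ t ω, ∏ i ∈ ({t + l + h, t + l, t + h, t} : Finset ℕ), x i ω =
          x (t + l + h) ω * x (t + l) ω * (x (t + h) ω * x t ω) := by
        intro t ω
        rw [Finset.prod_insert (by simp; omega), Finset.prod_insert (by simp; omega),
          Finset.prod_pair (by omega)]
        ring
      have h1 := hx.integral_abs_sum_prod_le (I := fun t => {t + l + h, t + l, t + h, t}) (d := 4)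
        (by simp) (by intro t i hi; simp at hi; omega)
        (by
          intro t
          rw [Finset.card_insert_of_notMem (by simp; omega),
            Finset.card_insert_of_notMem (by simp; omega), Finset.card_pair (by omega)])
        (Finset.Icc 1 (M - l))
      simp only [e] at h1
      refine h1.trans ?_
      have h2 := hx.sqrt_natCast_mul_le (M := M - l) (N := N) ((Nat.sub_le M l).trans hMN) 2
      simpa using h2

lemma integral_chirpCorrBound_le (hx : IsWhiteNoise μ x s) (N : ℕ) :
    Integrable (fun ω => chirpCorrBound (fun t => x t ω) N) μ ∧
      ∫ ω, chirpCorrBound (fun t => x t ω) N ∂μ ≤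
        N * s + 2 * (N * √(N * s ^ 2 + 2 * (N * (√(N : ℝ) * s ^ 2) + N * s ^ 2))) := by
  set B := N * s ^ 2 + 2 * (N * (√(N : ℝ) * s ^ 2) + N * s ^ 2) with hB
  have i1 : Integrable (fun ω => ∑ t ∈ Finset.Icc 1 N, x t ω ^ 2) μ :=
    integrable_finsetSum _ fun t _ => (hx.memLp t).integrable_sq
  have hL : ∀ h ∈ Finset.Ico 1 N,
      MemLp (fun ω => √(corrBound (fun t => x (t + h) ω * x t ω) (N - h))) 2 μ := by
    intro h hh
    have h1 := (hx.integral_corrBound_shift_le (Finset.mem_Ico.1 hh).1 (Nat.sub_le N h)).1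
    refine (memLp_two_iff_integrable_sq
      h1.1.aemeasurable.sqrt.aestronglyMeasurable).2 ?_
    simpa only [Real.sq_sqrt (corrBound_nonneg _ _)] using h1
  have i2 : ∀ h ∈ Finset.Ico 1 N,
      Integrable (fun ω => √(corrBound (fun t => x (t + h) ω * x t ω) (N - h))) μ := fun h hh =>
    (hL h hh).integrable (by norm_num)
  have i3 := integrable_finsetSum _ i2
  refine ⟨i1.add (i3.const_mul 2), ?_⟩
  simp only [chirpCorrBound]
  rw [integral_add i1 (i3.const_mul 2), integral_const_mul,
    integral_finsetSum _ fun t _ => (hx.memLp t).integrable_sq, integral_finsetSum _ i2]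
  have e1 : ∑ t ∈ Finset.Icc 1 N, ∫ ω, x t ω ^ 2 ∂μ = N * s := by simp [hx.integral_sq]
  have e2 : ∑ h ∈ Finset.Ico 1 N,
      ∫ ω, √(corrBound (fun t => x (t + h) ω * x t ω) (N - h)) ∂μ ≤ N * √B := by
    calc _ ≤ ∑ h ∈ Finset.Ico 1 N, √B := by
          refine Finset.sum_le_sum fun h hh => ?_
          have h1 := integral_abs_le_sqrt (hL h hh)
          simp only [abs_of_nonneg (Real.sqrt_nonneg _), Real.sq_sqrt (corrBound_nonneg _ _)] at h1
          exact h1.trans (Real.sqrt_le_sqrt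
            (hx.integral_corrBound_shift_le (Finset.mem_Ico.1 hh).1 (Nat.sub_le N h)).2)
      _ ≤ _ := by
          have : ((N - 1 : ℕ) : ℝ) ≤ N := by exact_mod_cast Nat.sub_le N 1
          simp only [Finset.sum_const, Nat.card_Ico, nsmul_eq_mul]
          gcongr
  linarith

end IsWhiteNoise

/-! ### Almost sure decorrelation of the linear process. -/

/-- The quadratic bound that controls the exponential sums of the innovations at `n = m ^ 8` and
between consecutive eighth powers. -/
noncomputable def noiseBound (x : ℕ → ℝ) (m : ℕ) : ℝ :=
  (corrBound x (m ^ 8) + chirpCorrBound x (m ^ 8)) / ((m : ℝ) ^ 8) ^ 2 +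
    (∑ t ∈ Finset.Ioc (m ^ 8) ((m + 1) ^ 8), x t ^ 2) / (m * (m : ℝ) ^ 8)

lemma noiseBound_nonneg (x : ℕ → ℝ) (m : ℕ) : 0 ≤ noiseBound x m := by
  have := corrBound_nonneg x (m ^ 8)
  have := chirpCorrBound_nonneg x (m ^ 8)
  unfold noiseBound; positivity

lemma norm_sum_sq_le_noiseBound {k : ℕ} (hk : k = 1 ∨ k = 2) (x : ℕ → ℝ) (m : ℕ) (β : ℝ) :
    ‖∑ t ∈ Finset.Icc 1 (m ^ 8), (x t : ℂ) * unitPhase k β t‖ ^ 2 ≤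
      ((m : ℝ) ^ 8) ^ 2 * noiseBound x m := by
  rcases Nat.eq_zero_or_pos m with rfl | hm
  · simp
  have hm' : (0 : ℝ) < m := by exact_mod_cast hm
  have h1 := corrBound_nonneg x (m ^ 8)
  have h2 := chirpCorrBound_nonneg x (m ^ 8)
  have h3 : corrBound x (m ^ 8) + chirpCorrBound x (m ^ 8) ≤ ((m : ℝ) ^ 8) ^ 2 * noiseBound x m := by
    unfold noiseBound
    rw [mul_add, mul_div_cancel₀ _ (by positivity)]
    have : 0 ≤ ((m : ℝ) ^ 8) ^ 2 *
      ((∑ t ∈ Finset.Ioc (m ^ 8) ((m + 1) ^ 8), x t ^ 2) / (m * (m : ℝ) ^ 8)) := by positivity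
    linarith
  rcases hk with rfl | rfl
  · linarith [norm_sum_mul_unitPhase_one_sq_le x (m ^ 8) β]
  · linarith [norm_sum_mul_unitPhase_two_sq_le x (m ^ 8) β]

lemma sum_Ioc_sq_le_noiseBound (x : ℕ → ℝ) {m : ℕ} (hm : 1 ≤ m) :
    ∑ t ∈ Finset.Ioc (m ^ 8) ((m + 1) ^ 8), x t ^ 2 ≤ m * (m : ℝ) ^ 8 * noiseBound x m := by
  have hm' : (0 : ℝ) < m := by exact_mod_cast hm
  have h1 := corrBound_nonneg x (m ^ 8)
  have h2 := chirpCorrBound_nonneg x (m ^ 8)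
  unfold noiseBound
  rw [mul_add, mul_div_cancel₀ _ (by positivity)]
  have : 0 ≤ m * (m : ℝ) ^ 8 *
    ((corrBound x (m ^ 8) + chirpCorrBound x (m ^ 8)) / ((m : ℝ) ^ 8) ^ 2) := by positivity
  linarith

lemma IsWhiteNoise.integral_noiseBound_le {Ω : Type*} [MeasurableSpace Ω] {μ : Measure Ω}
    [IsProbabilityMeasure μ] {x : ℕ → Ω → ℝ} {s : ℝ} (hx : IsWhiteNoise μ x s) {m : ℕ}
    (hm : 1 ≤ m) :
    Integrable (fun ω => noiseBound (fun t => x t ω) m) μ ∧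
      ∫ ω, noiseBound (fun t => x t ω) m ∂μ ≤ 265 * s / (m : ℝ) ^ 2 := by
  have hs := hx.nonneg
  have hm1 : (1 : ℝ) ≤ m := by exact_mod_cast hm
  obtain ⟨i1, e1⟩ := hx.integral_corrBound_le (m ^ 8)
  obtain ⟨i2, e2⟩ := hx.integral_chirpCorrBound_le (m ^ 8)
  have i3 : Integrable (fun ω => ∑ t ∈ Finset.Ioc (m ^ 8) ((m + 1) ^ 8), x t ω ^ 2) μ :=
    integrable_finsetSum _ fun t _ => (hx.memLp t).integrable_sq
  have e3 : ∫ ω, ∑ t ∈ Finset.Ioc (m ^ 8) ((m + 1) ^ 8), x t ω ^ 2 ∂μ =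
      (((m + 1 : ℕ) : ℝ) ^ 8 - (m : ℝ) ^ 8) * s := by
    rw [integral_finsetSum _ fun t _ => (hx.memLp t).integrable_sq]
    have hle : m ^ 8 ≤ (m + 1) ^ 8 := Nat.pow_le_pow_left (by omega) 8
    simp only [hx.integral_sq, Finset.sum_const, Nat.card_Ioc, nsmul_eq_mul]
    rw [Nat.cast_sub hle]
    push_cast
    ring
  have hN : ((m ^ 8 : ℕ) : ℝ) = (m : ℝ) ^ 8 := by push_cast; ring
  have hsq : √((m : ℝ) ^ 8) = (m : ℝ) ^ 4 := by
    rw [show (m : ℝ) ^ 8 = ((m : ℝ) ^ 4) ^ 2 by ring, Real.sqrt_sq (by positivity)]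
  rw [hN, hsq] at e1 e2
  have hpow : ∀ i j : ℕ, i ≤ j → (m : ℝ) ^ i ≤ (m : ℝ) ^ j := fun i j h => pow_le_pow_right₀ hm1 h
  have e1' : ∫ ω, corrBound (fun t => x t ω) (m ^ 8) ∂μ ≤ 3 * s * (m : ℝ) ^ 14 := by
    refine e1.trans ?_
    have a1 := mul_le_mul_of_nonneg_right (hpow 8 14 (by norm_num)) hs
    have a2 := mul_le_mul_of_nonneg_right (hpow 12 14 (by norm_num)) hs
    have : (m : ℝ) ^ 8 * ((m : ℝ) ^ 4 * s) = (m : ℝ) ^ 12 * s := by ring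
    rw [this]; linarith
  -- This is the order `N ^ (7 / 4)` with `N = m ^ 8`. After division by `N ^ 2` it leaves `m ^
  -- (-2)`, which is summable; the gap term below has the same order.
  have e2' : ∫ ω, chirpCorrBound (fun t => x t ω) (m ^ 8) ∂μ ≤ 7 * s * (m : ℝ) ^ 14 := by
    refine e2.trans ?_
    have b1 : √((m : ℝ) ^ 8 * s ^ 2 + 2 * ((m : ℝ) ^ 8 * ((m : ℝ) ^ 4 * s ^ 2) +
        (m : ℝ) ^ 8 * s ^ 2)) ≤ 3 * (m : ℝ) ^ 6 * s := by
      refine Real.sqrt_le_iff.2 ⟨by positivity, ?_⟩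
      have a1 := mul_le_mul_of_nonneg_right (hpow 8 12 (by norm_num)) (sq_nonneg s)
      have a3 : 0 ≤ (m : ℝ) ^ 12 * s ^ 2 := by positivity
      have e : (3 * (m : ℝ) ^ 6 * s) ^ 2 = 9 * ((m : ℝ) ^ 12 * s ^ 2) := by ring
      have e' : (m : ℝ) ^ 8 * ((m : ℝ) ^ 4 * s ^ 2) = (m : ℝ) ^ 12 * s ^ 2 := by ring
      rw [e, e']; linarith
    have b2 := mul_le_mul_of_nonneg_left b1 (by positivity : 0 ≤ (m : ℝ) ^ 8)
    have a1 := mul_le_mul_of_nonneg_right (hpow 8 14 (by norm_num)) hs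
    have e : (m : ℝ) ^ 8 * (3 * (m : ℝ) ^ 6 * s) = 3 * ((m : ℝ) ^ 14 * s) := by ring
    rw [e] at b2
    linarith
  have i4 : Integrable (fun ω => (corrBound (fun t => x t ω) (m ^ 8) +
      chirpCorrBound (fun t => x t ω) (m ^ 8)) / ((m : ℝ) ^ 8) ^ 2) μ := (i1.add i2).div_const _
  have i5 := i3.div_const (m * (m : ℝ) ^ 8)
  refine ⟨i4.add i5, ?_⟩
  simp only [noiseBound]
  rw [integral_add i4 i5, integral_div, integral_div, integral_add i1 i2, e3]
  have c1 : (∫ ω, corrBound (fun t => x t ω) (m ^ 8) ∂μ +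
      ∫ ω, chirpCorrBound (fun t => x t ω) (m ^ 8) ∂μ) / ((m : ℝ) ^ 8) ^ 2 ≤
      10 * s / (m : ℝ) ^ 2 := by
    rw [div_le_div_iff₀ (by positivity) (by positivity)]
    calc _ ≤ (3 * s * (m : ℝ) ^ 14 + 7 * s * (m : ℝ) ^ 14) * (m : ℝ) ^ 2 := by gcongr
      _ = _ := by ring
  have c2 : (((m + 1 : ℕ) : ℝ) ^ 8 - (m : ℝ) ^ 8) * s / (m * (m : ℝ) ^ 8) ≤
      255 * s / (m : ℝ) ^ 2 := by
    rw [div_le_div_iff₀ (by positivity) (by positivity)]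
    calc _ = (m * (((m + 1 : ℕ) : ℝ) ^ 8 - (m : ℝ) ^ 8)) * (s * m) := by ring
      _ ≤ (255 * (m : ℝ) ^ 8) * (s * m) :=
        mul_le_mul_of_nonneg_right (mul_pow_eight_gap_le hm) (by positivity)
      _ = _ := by ring
  have : 265 * s / (m : ℝ) ^ 2 = 10 * s / (m : ℝ) ^ 2 + 255 * s / (m : ℝ) ^ 2 := by ring
  linarith

/-- Weighted sums of nonnegative variables with summable means vanish almost surely. -/
lemma ae_tendsto_tsum_of_integral_le {Ω : Type*} [MeasurableSpace Ω] {μ : Measure Ω}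
    {a : ℤ → ℝ} (ha : Summable fun j => |a j|) {R : ℕ → ℤ → Ω → ℝ} {C : ℝ} (hC : 0 ≤ C)
    (hR0 : ∀ m j ω, 0 ≤ R m j ω) (hint : ∀ m j, 1 ≤ m → Integrable (R m j) μ)
    (hle : ∀ m j, 1 ≤ m → ∫ ω, R m j ω ∂μ ≤ C / (m : ℝ) ^ 2) :
    ∀ᵐ ω ∂μ, (∀ᶠ m in atTop, Summable fun j => |a j| * R m j ω) ∧
      Tendsto (fun m => ∑' j, |a j| * R m j ω) atTop (𝓝 0) := by
  have hF0 : ∀ m j ω, 0 ≤ |a j| * R m j ω := fun m j ω => mul_nonneg (abs_nonneg _) (hR0 m j ω)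
  -- The index is shifted by one because the moment hypotheses start at `m = 1`.
  have hmeas : ∀ m j, AEMeasurable (fun ω => ENNReal.ofReal (|a j| * R (m + 1) j ω)) μ :=
    fun m j => ((hint (m + 1) j (by omega)).const_mul _).aemeasurable.ennreal_ofReal
  have hlin : ∀ m, ∫⁻ ω, ∑' j, ENNReal.ofReal (|a j| * R (m + 1) j ω) ∂μ ≤
      ENNReal.ofReal ((∑' j, |a j|) * (C / ((m + 1 : ℕ) : ℝ) ^ 2)) := by
    intro m
    rw [lintegral_tsum (hmeas m), ← tsum_mul_right, ENNReal.ofReal_tsum_of_nonneg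
      (fun j => by positivity) (ha.mul_right _)]
    refine ENNReal.tsum_le_tsum fun j => ?_
    rw [← ofReal_integral_eq_lintegral_ofReal ((hint (m + 1) j (by omega)).const_mul _)
      (Eventually.of_forall fun ω => hF0 _ _ _), integral_const_mul]
    exact ENNReal.ofReal_le_ofReal
      (mul_le_mul_of_nonneg_left (hle (m + 1) j (by omega)) (abs_nonneg _))
  have hs : Summable fun m : ℕ => (∑' j, |a j|) * (C / ((m + 1 : ℕ) : ℝ) ^ 2) := by
    have h1 : Summable fun m : ℕ => 1 / ((m : ℝ) ^ 2) :=
      Real.summable_one_div_nat_pow.2 (by norm_num)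
    have h2 := ((summable_nat_add_iff 1).2 h1).mul_left ((∑' j, |a j|) * C)
    refine h2.congr fun m => ?_
    ring
  -- Finiteness of the mean of the double series makes it finite almost surely, so its terms in `m`
  -- tend to zero.
  have hfin : ∫⁻ ω, ∑' m, ∑' j, ENNReal.ofReal (|a j| * R (m + 1) j ω) ∂μ ≠ ⊤ := by
    rw [lintegral_tsum fun m => AEMeasurable.tsum (hmeas m)]
    refine ne_top_of_le_ne_top ?_ (ENNReal.tsum_le_tsum hlin)
    rw [← ENNReal.ofReal_tsum_of_nonneg (fun m => ?_) hs]
    · exact ENNReal.ofReal_ne_top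
    · exact mul_nonneg (tsum_nonneg fun _ => abs_nonneg _) (by positivity)
  have hae := ae_lt_top' (AEMeasurable.tsum fun m => AEMeasurable.tsum (hmeas m))
    hfin
  filter_upwards [hae] with ω hω
  have hsum : ∀ m, Summable fun j => |a j| * R (m + 1) j ω := by
    intro m
    have h1 : ∑' j, ENNReal.ofReal (|a j| * R (m + 1) j ω) ≠ ⊤ :=
      ne_top_of_le_ne_top hω.ne (ENNReal.le_tsum m)
    have h2 := ENNReal.summable_toReal h1
    refine h2.congr fun j => ?_
    rw [ENNReal.toReal_ofReal (hF0 _ _ _)]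
  have ht := ENNReal.tendsto_atTop_zero_of_tsum_ne_top hω.ne
  have ht' : Tendsto (fun m => ∑' j, |a j| * R (m + 1) j ω) atTop (𝓝 0) := by
    have := (ENNReal.tendsto_toReal ENNReal.zero_ne_top).comp ht
    rw [ENNReal.toReal_zero] at this
    refine this.congr fun m => ?_
    simp only [Function.comp_apply]
    rw [← ENNReal.ofReal_tsum_of_nonneg (fun j => hF0 _ _ _) (hsum m),
      ENNReal.toReal_ofReal (tsum_nonneg fun j => hF0 _ _ _)]
  refine ⟨?_, (tendsto_add_atTop_iff_nat 1).1 ht'⟩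
  filter_upwards [eventually_ge_atTop 1] with m hm
  obtain ⟨m, rfl⟩ := Nat.exists_eq_add_of_le' hm
  exact hsum m

lemma IsLinearProcess.isWhiteNoise {Ω : Type*} [MeasurableSpace Ω] {μ : Measure Ω}
    {X : ℤ → Ω → ℝ} {a : ℤ → ℝ} {e : ℤ → Ω → ℝ} {σ : ℝ} (hX : IsLinearProcess μ X a e σ) (j : ℤ) :
    IsWhiteNoise μ (fun (t : ℕ) => e ((t : ℤ) - j)) (σ ^ 2) where
  indep := hX.indep.precomp (g := fun t : ℕ => (t : ℤ) - j) fun s t h => by simpa using h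
  memLp t := hX.memLp _
  mean_eq_zero t := hX.mean_eq_zero _
  integral_sq t := by
    rw [← hX.variance_eq ((t : ℤ) - j), variance_of_integral_eq_zero
      (hX.memLp _).1.aemeasurable (hX.mean_eq_zero _)]

/-- Almost surely the linear process decorrelates from every sinusoid and every chirp. -/
theorem IsLinearProcess.ae_decorrelates {Ω : Type*} [MeasurableSpace Ω] {μ : Measure Ω}
    [IsProbabilityMeasure μ] {X : ℤ → Ω → ℝ} {a : ℤ → ℝ} {e : ℤ → Ω → ℝ} {σ : ℝ}
    (hX : IsLinearProcess μ X a e σ) :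
    ∀ᵐ ω ∂μ, ∀ k, k = 1 ∨ k = 2 → ∀ β, Decorrelates k (fun t => X t ω) β := by
  have h1 := ae_tendsto_tsum_of_integral_le (μ := μ) hX.summable_abs
    (R := fun m j ω => noiseBound (fun t => e ((t : ℤ) - j) ω) m) (C := 265 * σ ^ 2)
    (by positivity) (fun m j ω => noiseBound_nonneg _ _)
    (fun m j hm => ((hX.isWhiteNoise j).integral_noiseBound_le hm).1)
    (fun m j hm => ((hX.isWhiteNoise j).integral_noiseBound_le hm).2)
  filter_upwards [h1, ae_all_iff.2 hX.hasSum] with ω hω hsum k hk β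
  exact decorrelates_of_hasSum hX.summable_abs (x := fun j t => e ((t : ℤ) - j) ω)
    (fun t => hsum t) (fun m j β => norm_sum_sq_le_noiseBound hk _ m β)
    (fun m j hm => sum_Ioc_sq_le_noiseBound _ hm) hω.1 hω.2 β

/-! ### The sequential fit. -/

lemma mem_of_mem_interior_paramSpace {M : ℝ} {θ : ℝ × ℝ × ℝ}
    (h : θ ∈ interior (paramSpace (Set.Icc (-M) M))) : θ.2.2 ∈ Set.Ioo 0 Real.pi := by
  rw [paramSpace, interior_prod_eq, interior_prod_eq, interior_Icc, interior_Icc] at h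
  exact h.2.2

lemma paramSpace_mono {K K' : Set ℝ} (h : K ⊆ K') : paramSpace K ⊆ paramSpace K' :=
  Set.prod_mono h (Set.prod_mono h subset_rfl)

lemma tendsto_norm_vec_sum {ι : Type*} {k : ℕ} (s : Finset ι) {θ : ι → ℝ × ℝ × ℝ}
    {est : ℕ → ι → ℝ × ℝ × ℝ} (h : ∀ i ∈ s, Tendsto (fun n =>
      ‖vec n (powHarmonic k (est n i)) - vec n (powHarmonic k (θ i))‖) atTop (𝓝 0)) :
    Tendsto (fun n => ‖vec n (fun t => ∑ i ∈ s,
      (powHarmonic k (θ i) t - powHarmonic k (est n i) t))‖) atTop (𝓝 0) := by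
  have h1 := tendsto_finsetSum s h
  rw [Finset.sum_const_zero] at h1
  refine squeeze_zero (fun _ => norm_nonneg _) (fun n => ?_) h1
  have e : (fun t => ∑ i ∈ s, (powHarmonic k (θ i) t - powHarmonic k (est n i) t)) =
      ∑ i ∈ s, (powHarmonic k (θ i) - powHarmonic k (est n i)) := by
    funext t; simp
  rw [e, map_sum]
  refine (norm_sum_le _ _).trans (Finset.sum_le_sum fun i _ => ?_)
  rw [map_sub, norm_sub_rev]

theorem theorem7 {Ω : Type*} [MeasurableSpace Ω] (μ : Measure Ω) [IsProbabilityMeasure μ]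
    -- the noise
    (X : ℤ → Ω → ℝ) (a : ℤ → ℝ) (e : ℤ → Ω → ℝ) (σ : ℝ) (hX : IsLinearProcess μ X a e σ)
    -- the true parameters: sinusoids `(A, B, α)` and chirp components `(C, D, β)`
    (p q : ℕ) (θs : Fin p → ℝ × ℝ × ℝ) (θc : Fin q → ℝ × ℝ × ℝ)
    (M : ℝ) (hM : 0 < M)
    (hint : (θs, θc) ∈ interior
      ((Set.univ.pi fun _ : Fin p => paramSpace (Set.Icc (-M) M)) ×ˢ
        (Set.univ.pi fun _ : Fin q => paramSpace (Set.Icc (-M) M))))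
    (hα : Function.Injective fun j => (θs j).2.2)
    (hβ : Function.Injective fun k => (θc k).2.2)
    (hAB : StrictAnti fun j => sqAmplitude (θs j)) (hAB_pos : ∀ j, 0 < sqAmplitude (θs j))
    (hCD : StrictAnti fun k => sqAmplitude (θc k)) (hCD_pos : ∀ k, 0 < sqAmplitude (θc k))
    -- the frequency rates avoid the exceptional countable set
    (hirr : ∀ k, Irrational ((θc k).2.2 / Real.pi))
    -- the estimators; the amplitudes range over `[-M, M]`, over `ℝ` or over a set in between
    (K : Set ℝ) (hK : Set.Icc (-M) M ⊆ K)
    (estS : ℕ → Ω → Fin p → ℝ × ℝ × ℝ) (estC : ℕ → Ω → Fin q → ℝ × ℝ × ℝ)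
    (hest : ∀ᵐ ω ∂μ, ∀ᶠ n : ℕ in atTop,
      IsSequentialLSE K n (observation θs θc fun t => X t ω) (estS n ω) (estC n ω)) :
    (∀ hp : 0 < p, ∀ᵐ ω ∂μ,
      Tendsto (fun n => estS n ω ⟨0, hp⟩) atTop (𝓝 (θs ⟨0, hp⟩))) ∧
    (∀ hq : 0 < q,
      (∀ k l, k ≠ l → Irrational (((θc k).2.2 + (θc l).2.2) / Real.pi) ∧
        Irrational (((θc k).2.2 - (θc l).2.2) / Real.pi)) →
      ∀ᵐ ω ∂μ, Tendsto (fun n => estC n ω ⟨0, hq⟩) atTop (𝓝 (θc ⟨0, hq⟩))) := by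
  rw [interior_prod_eq, interior_pi_set Set.finite_univ, interior_pi_set Set.finite_univ] at hint
  have hintS : ∀ j, θs j ∈ interior (paramSpace (Set.Icc (-M) M)) := fun j => hint.1 j trivial
  have hintC : ∀ k, θc k ∈ interior (paramSpace (Set.Icc (-M) M)) := fun k => hint.2 k trivial
  have hKS : ∀ j, θs j ∈ paramSpace K := fun j => paramSpace_mono hK (interior_subset (hintS j))
  have hKC : ∀ k, θc k ∈ paramSpace K := fun k => paramSpace_mono hK (interior_subset (hintC k))
  have hsepS : SeparatedFrequencies 1 fun j => (θs j).2.2 :=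
    separatedFrequencies_one (fun j => mem_of_mem_interior_paramSpace (hintS j)) hα
  have hS : ∀ᵐ ω ∂μ, ∀ j, Tendsto (fun n =>
      ‖vec n (powHarmonic 1 (estS n ω j)) - vec n (powHarmonic 1 (θs j))‖) atTop (𝓝 0) ∧
      Tendsto (fun n => estS n ω j) atTop (𝓝 (θs j)) := by
    filter_upwards [hest, hX.ae_decorrelates] with ω hω hdec j
    -- At step `j` the remaining sinusoids form `J`, of which `j` is the strongest; the chirps join
    -- the noise in `w`, and the errors of the earlier fits form the remainder `r`.
    induction j using WellFoundedLT.induction with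
    | ind j ih =>
    refine leastSquares_consistent (Or.inl rfl) hsepS (J := (Finset.Iio j)ᶜ) (by simp)
      (fun i hi hij => hAB (lt_of_le_of_ne (by simpa using hi) hij.symm)) (hAB_pos j) (hKS j)
      (w := fun t => ∑ k, powHarmonic 2 (θc k) t + X t ω)
      (fun b _ => (Decorrelates.sum _ fun k _ => decorrelates_chirp (hirr k) b).add
        (hdec 1 (Or.inl rfl) b))
      (tendsto_norm_vec_sum (est := fun n => estS n ω) (Finset.Iio j)
        fun i hi => (ih i (Finset.mem_Iio.1 hi)).1) ?_
    filter_upwards [hω] with n hn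
    have h := hn.sinusoid_step j
    rw [sinusoid_eq_powHarmonic] at h
    convert h using 2 with t
    rw [observation, ← Finset.sum_add_sum_compl (Finset.Iio j) fun i => sinusoid (θs i) t,
      Finset.sum_sub_distrib, sinusoid_eq_powHarmonic, chirp_eq_powHarmonic]
    ring
  refine ⟨fun hp => hS.mono fun ω hω => (hω ⟨0, hp⟩).2, fun hq hpair => ?_⟩
  have hsepC : SeparatedFrequencies 2 fun k => (θc k).2.2 :=
    separatedFrequencies_two (fun k => mem_of_mem_interior_paramSpace (hintC k)) hirr hpair
  filter_upwards [hest, hX.ae_decorrelates, hS] with ω hω hdec hSω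
  -- All fitted sinusoids enter only through a remainder that vanishes in mean square, so the first
  -- chirp fit is again a single step.
  refine (leastSquares_consistent (Or.inr rfl) hsepC (J := Finset.univ) (i₀ := ⟨0, hq⟩)
    (Finset.mem_univ _) (fun i _ hi => hCD (lt_of_le_of_ne (Fin.mk_le_of_le_val (Nat.zero_le _))
      hi.symm)) (hCD_pos _) (hKC _) (w := fun t => X t ω) (fun b _ => hdec 2 (Or.inr rfl) b)
      (tendsto_norm_vec_sum (est := fun n => estS n ω) Finset.univ fun i _ => (hSω i).1) ?_).2
  filter_upwards [hω] with n hn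
  have h := hn.chirp_step ⟨0, hq⟩
  rw [chirp_eq_powHarmonic] at h
  convert h using 2 with t
  have h0 : Finset.Iio (⟨0, hq⟩ : Fin q) = ∅ := by
    ext i; simp [Fin.lt_def]
  rw [observation, h0, Finset.sum_empty, Finset.sum_sub_distrib, sinusoid_eq_powHarmonic,
    chirp_eq_powHarmonic]
  ring
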